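/- **Corollary 2.5.** Let $p\ge 1$, $T>0$, let $\Omega=\mathbb T^p=(\mathbb R/\mathbb Z)^p$ be the periodic box of unit volume, $Q_T=(0,T)\times\Omega$, and let $(\cdot,\cdot)$ denote the scalar products of $L^2(\Omega;\mathbb R^p)$ and $L^2(\Omega;\mathbb R^{p\times p}_s)$ (Frobenius product; the index $s$ means symmetric matrices), and more generally the pairings given by the same integrals. For $v_0\in L^2(\Omega;\mathbb R^p)$ and a base state $\bar v\in L^2(Q_T;\mathbb R^p)$ call a pair $(E,B)\in L^2(Q_T;\mathbb R^p)\times L^\infty(Q_T;\mathbb R^{p\times p}_s)$ *admissible* if $$\int_0^T\big[(B,\partial_t\Psi)+(E,L\Psi)\big]\,dt=0,\qquad L\Psi:=-\tfrac12\nabla\operatorname{tr}\Psi,$$ for every smooth $\Psi:[0,T]\times\Omega\to\mathbb R^{p\times p}_s$ with $\Psi(0,\cdot)=0$, and put $$\mathcal I(v_0,\bar v,T)=\inf_{w}\ \sup_{(E,B)}\int_0^T\big[\tfrac12(w-\bar v,w-\bar v)+(w-v_0,E)+(w\otimes w,B)\big]\,dt,$$ $$\mathcal J(v_0,\bar v,T)=\sup_{(E,B)}\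 \inf_{w}\int_0^T\big[(w-v_0,E-\bar v)+\tfrac12(w\otimes w,I+2B)\big]\,dt+\int_0^T\big[-(v_0,\bar v)+\tfrac12(\bar v,\bar v)\big]\,dt,$$ where $w$ ranges over $L^2(Q_T;\mathbb R^p)$ and $(E,B)$ over the admissible pairs (values in $[-\infty,+\infty]$). A *solution of the dual problem* with base state $\bar v$ is a maximizer $(E,B)$, with maximal value $\mathcal J(v_0,\bar v,T)$, of $$\int_0^T\big[-(v_0,E)+\tfrac12(\bar v,\bar v)\big]\,dt+\mathcal K(E-\bar v,B)$$ over all admissible pairs with $I+2B\ge0$ a.e. in $Q_T$, where $$\mathcal K(Q,B)=\inf\Big\{\int_0^T\big[(z,Q)+\tfrac12(M,I+2B)\big]\,dt:\ z\in L^2(Q_T;\mathbb R^p),\ M\in L^1(Q_T;\mathbb R^{p\times p}_s),\ z\otimes z\le M\text{ a.e.}\Big\}.$$ Let $\psi$ be the (continuous on $[0,T]\times\Omega$) viscosity solution of the quadratic Hamilton–Jacobi problem $$\partial_t\psi+\tfrac12|\nabla\psi|^2=0\ \text{ in } (0,T)\times\Omega,\qquad \psi(0,\cdot)=\psi_*,$$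 and assume that the gradients $v_0=\nabla\psi_*$ and $v=\nabla\psi$ exist and are continuous on $\Omega$ and on $[0,T]\times\Omega$, respectively. Then there exists a sequence of continuous base states $\bar v_m:[0,T]\times\Omega\to\mathbb R^p$ such that: i) $\bar v_m\to0$ strongly in $L^1((0,T)\times\Omega;\mathbb R^p)$; ii) $\mathcal I(v_0,\bar v_m,T)=\mathcal J(v_0,\bar v_m,T)$ for every $m$; iii) for every $m$ the dual problem with base state $\bar v_m$ has a solution $(E_m,B_m)$ that is smooth on $[0,T]\times\Omega$ and satisfies $I+2B_m>0$ (positive definite) in $(0,T)\times\Omega$; iv) for every $m$, $v=(I+2B_m)^{-1}(\bar v_m-E_m)$ in $(0,T)\times\Omega$. -/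

import Mathlib

open MeasureTheory Set Filter Topology
open scoped ContDiff ENNReal Gradient

noncomputable section

namespace HJDual

/-- Euclidean space `ℝ^p`, the space of values of the vector fields (one player, `n = p`). -/
abbrev Vec (p : ℕ) := EuclideanSpace ℝ (Fin p)

/-- Real `p × p` matrices. -/
abbrev Mat (p : ℕ) := Matrix (Fin p) (Fin p) ℝ

/-- The periodic box `Ω = 𝕋^p`, a product of circles of length one. -/
abbrev Torus (p : ℕ) := Fin p → UnitAddCircle

/-- The covering map `ℝ^p → 𝕋^p`. -/
def Torus.mk {p : ℕ} (y : Vec p) : Torus p := fun i => ((y i : ℝ) : UnitAddCircle)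

/-- Lebesgue measure on `(0,T) × Ω`. -/
def spaceTime (p : ℕ) (T : ℝ) : Measure (ℝ × Torus p) :=
  ((volume : Measure ℝ).restrict (Ioo 0 T)).prod (volume : Measure (Torus p))

/-- A field on `[0,T] × Ω` is smooth (up to the end points of the time interval) when its periodic
lift to `[0,T] × ℝ^p` is of class `C^∞`. -/
def SmoothField {p : ℕ} {F : Type*} [NormedAddCommGroup F] [NormedSpace ℝ F] (T : ℝ)
    (f : ℝ × Torus p → F) : Prop :=
  ContDiffOn ℝ ∞ (fun z : ℝ × Vec p => f (z.1, Torus.mk z.2)) (Icc 0 T ×ˢ univ)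

/-- A matrix field is smooth when its entries are. -/
def SmoothMatField {p : ℕ} (T : ℝ) (A : ℝ × Torus p → Mat p) : Prop :=
  ∀ i j, SmoothField T (fun z => A z i j)

/-- The Frobenius scalar product of matrices. -/
def frob {p : ℕ} (A B : Mat p) : ℝ := ∑ i, ∑ j, A i j * B i j

/-- The tensor square `v ⊗ v`. -/
def tsq {p : ℕ} (v : Vec p) : Mat p := Matrix.of fun i j => v i * v j

/-- The gradient of a function on the torus: the `i`-th entry is the derivative along the `i`-th
circle. -/
def torusGrad {p : ℕ} (f : Torus p → ℝ) (x : Torus p) : Vec p :=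
  WithLp.toLp 2 fun i => deriv (fun s : ℝ => f (x + Pi.single i (s : UnitAddCircle))) 0

/-- The linear map `𝔘 = ½ tr` of the single-player problem, for which
`∂ₜψ + 𝔘(∇ψ ⊗ ∇ψ) = 0` is the quadratic Hamilton-Jacobi equation. -/
def opU {p : ℕ} (A : Mat p) : ℝ := (1 / 2) * A.trace

/-- The operator `L w = -∇(𝔘 w)` acting in the space variable. -/
def opL {p : ℕ} (w : Torus p → Mat p) (x : Torus p) : Vec p :=
  -torusGrad (fun y => opU (w y)) x

/-- The entrywise time derivative of a matrix field. -/
def timeDeriv {p : ℕ} (A : ℝ × Torus p → Mat p) (z : ℝ × Torus p) : Mat p :=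
  Matrix.of fun i j => deriv (fun s : ℝ => A (s, z.2) i j) z.1

/-- Test fields: smooth fields of symmetric matrices on `[0,T] × Ω` that vanish at `t = 0`. -/
structure IsTestField {p : ℕ} (T : ℝ) (Ψ : ℝ × Torus p → Mat p) : Prop where
  smooth : SmoothMatField T Ψ
  symm : ∀ z, (Ψ z).IsSymm
  initial : ∀ x, Ψ (0, x) = 0

/-- The pairs `(E,B)` of the class `L² × L^∞_s` that satisfy
`∫₀ᵀ [(B, ∂ₜΨ) + (E, LΨ)] dt = 0` for all test fields `Ψ`. -/
structure Admissible {p : ℕ} (T : ℝ) (E : ℝ × Torus p → Vec p) (B : ℝ × Torus p → Mat p) :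
    Prop where
  memLp_E : MemLp E 2 (spaceTime p T)
  memLp_B : ∀ i j, MemLp (fun z => B z i j) ∞ (spaceTime p T)
  symm_B : ∀ᵐ z ∂(spaceTime p T), (B z).IsSymm
  constraint : ∀ Ψ : ℝ × Torus p → Mat p, IsTestField T Ψ →
    ∫ z, (frob (B z) (timeDeriv Ψ z) + inner ℝ (E z) (opL (fun x => Ψ (z.1, x)) z.2))
      ∂(spaceTime p T) = 0

/-- The value of the primal problem: the infimum over `v ∈ L²` of the supremum over admissible
`(E,B)` of `∫₀ᵀ [½ (v - v̄, v - v̄) + (v - v₀, E) + (v ⊗ v, B)] dt`. -/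
def primalValue {p : ℕ} (v₀ : Torus p → Vec p) (vbar : ℝ × Torus p → Vec p) (T : ℝ) : EReal :=
  ⨅ (v : ℝ × Torus p → Vec p) (_ : MemLp v 2 (spaceTime p T)),
    ⨆ (E : ℝ × Torus p → Vec p) (B : ℝ × Torus p → Mat p) (_ : Admissible T E B),
      ((∫ z, ((1 / 2) * inner ℝ (v z - vbar z) (v z - vbar z)
        + inner ℝ (v z - v₀ z.2) (E z) + frob (tsq (v z)) (B z)) ∂(spaceTime p T) : ℝ) : EReal)

/-- The constant `∫₀ᵀ [-(v₀, v̄) + ½ (v̄, v̄)] dt`. -/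
def baseConst {p : ℕ} (v₀ : Torus p → Vec p) (vbar : ℝ × Torus p → Vec p) (T : ℝ) : ℝ :=
  ∫ z, (-inner ℝ (v₀ z.2) (vbar z) + (1 / 2) * inner ℝ (vbar z) (vbar z)) ∂(spaceTime p T)

/-- The value of the dual problem: the supremum over admissible `(E,B)` of the infimum over
`v ∈ L²` of `∫₀ᵀ [(v - v₀, E - v̄) + ½ (v ⊗ v, I + 2B)] dt + C(v̄, v₀)`. -/
def dualValue {p : ℕ} (v₀ : Torus p → Vec p) (vbar : ℝ × Torus p → Vec p) (T : ℝ) : EReal :=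
  ⨆ (E : ℝ × Torus p → Vec p) (B : ℝ × Torus p → Mat p) (_ : Admissible T E B),
    ⨅ (v : ℝ × Torus p → Vec p) (_ : MemLp v 2 (spaceTime p T)),
      (((∫ z, (inner ℝ (v z - v₀ z.2) (E z - vbar z)
        + (1 / 2) * frob (tsq (v z)) (1 + (2 : ℝ) • B z)) ∂(spaceTime p T))
        + baseConst v₀ vbar T : ℝ) : EReal)

/-- The pairs `(z,M) ∈ L² × L¹_s` with `z ⊗ z ≤ M` almost everywhere. -/
structure MomentPair {p : ℕ} (T : ℝ) (z : ℝ × Torus p → Vec p) (M : ℝ × Torus p → Mat p) :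
    Prop where
  memLp_z : MemLp z 2 (spaceTime p T)
  memLp_M : ∀ i j, MemLp (fun y => M y i j) 1 (spaceTime p T)
  symm_M : ∀ᵐ y ∂(spaceTime p T), (M y).IsSymm
  le : ∀ᵐ y ∂(spaceTime p T), (M y - tsq (z y)).PosSemidef

/-- The functional `K(Q,B)`, the infimum of `∫₀ᵀ [(z, Q) + ½ (M, I + 2B)] dt` over all pairs
`(z,M) ∈ L² × L¹_s` with `z ⊗ z ≤ M`; it may take the value `-∞`. -/
def funcK {p : ℕ} (T : ℝ) (Q : ℝ × Torus p → Vec p) (B : ℝ × Torus p → Mat p) : EReal :=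
  ⨅ (z : ℝ × Torus p → Vec p) (M : ℝ × Torus p → Mat p) (_ : MomentPair T z M),
    ((∫ y, (inner ℝ (z y) (Q y) + (1 / 2) * frob (M y) (1 + (2 : ℝ) • B y))
      ∂(spaceTime p T) : ℝ) : EReal)

/-- The objective `∫₀ᵀ [-(v₀, E) + ½ (v̄, v̄)] dt + K(E - v̄, B)` of the concave maximization form
of the dual problem. -/
def dualObjective {p : ℕ} (v₀ : Torus p → Vec p) (vbar : ℝ × Torus p → Vec p) (T : ℝ)
    (E : ℝ × Torus p → Vec p) (B : ℝ × Torus p → Mat p) : EReal :=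
  ((∫ z, (-inner ℝ (v₀ z.2) (E z) + (1 / 2) * inner ℝ (vbar z) (vbar z))
    ∂(spaceTime p T) : ℝ) : EReal) + funcK T (fun z => E z - vbar z) B

/-- The feasible pairs of the concave maximization form: admissible with `I + 2B ≥ 0` a.e. -/
def DualFeasible {p : ℕ} (T : ℝ) (E : ℝ × Torus p → Vec p) (B : ℝ × Torus p → Mat p) : Prop :=
  Admissible T E B ∧ ∀ᵐ z ∂(spaceTime p T), (1 + (2 : ℝ) • B z).PosSemidef

/-- `(E,B)` solves the dual problem: it is feasible, maximizes the objective among all feasible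
pairs, and the maximum is the dual value. -/
structure IsDualSolution {p : ℕ} (v₀ : Torus p → Vec p) (vbar : ℝ × Torus p → Vec p) (T : ℝ)
    (E : ℝ × Torus p → Vec p) (B : ℝ × Torus p → Mat p) : Prop where
  feasible : DualFeasible T E B
  maximal : ∀ E' B', DualFeasible T E' B' →
    dualObjective v₀ vbar T E' B' ≤ dualObjective v₀ vbar T E B
  value : dualObjective v₀ vbar T E B = dualValue v₀ vbar T

/-- Viscosity solutions of the Cauchy problem `∂ₜψ + ½ |∇ψ|² = 0` in `(0,T) × Ω`, `ψ(0,·) = ψ⋆`: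
continuous on `[0,T] × Ω`, with the usual inequalities at the points where a `C¹` test function
touches the (lifted) function from above or from below. -/
structure IsViscositySolution {p : ℕ} (T : ℝ) (ψs : Torus p → ℝ) (ψ : ℝ × Torus p → ℝ) :
    Prop where
  continuousOn : ContinuousOn ψ (Icc 0 T ×ˢ univ)
  initial : ∀ x, ψ (0, x) = ψs x
  subsolution : ∀ φ : ℝ × Vec p → ℝ, ContDiff ℝ 1 φ → ∀ t ∈ Ioo 0 T, ∀ y : Vec p,
    IsLocalMax (fun z : ℝ × Vec p => ψ (z.1, Torus.mk z.2) - φ z) (t, y) →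
      deriv (fun s => φ (s, y)) t + (1 / 2) * ‖∇ (fun w => φ (t, w)) y‖ ^ 2 ≤ 0
  supersolution : ∀ φ : ℝ × Vec p → ℝ, ContDiff ℝ 1 φ → ∀ t ∈ Ioo 0 T, ∀ y : Vec p,
    IsLocalMin (fun z : ℝ × Vec p => ψ (z.1, Torus.mk z.2) - φ z) (t, y) →
      0 ≤ deriv (fun s => φ (s, y)) t + (1 / 2) * ‖∇ (fun w => φ (t, w)) y‖ ^ 2

/-- `g` is the (classical) gradient of `f` on the torus: the lift of `f` to `ℝ^p` is
differentiable everywhere with gradient the lift of `g`. -/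
def IsTorusGradient {p : ℕ} (f : Torus p → ℝ) (g : Torus p → Vec p) : Prop :=
  ∀ y : Vec p, HasGradientAt (fun w => f (Torus.mk w)) (g (Torus.mk y)) y

end HJDual

end

/-!
# Smooth dual solutions for the quadratic Hamilton-Jacobi equation

Let `v = ∇ψ`. Two facts carry the argument.

*`v` is a weak solution.* Since `ψ` is a viscosity solution with continuous spatial gradient,
`ψ(t,x) = ψ⋆(x) - ½ ∫₀ᵗ |v(s,x)|² ds` on every time line (`IsViscositySolution.integral_eq`). Hence
`Ψ(t) = ∫₀ᵗ v ⊗ v` formally is a test field with `∂ₜΨ = v ⊗ v` and `LΨ = v - v₀`; a mollification in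
space and a Bernstein interpolation in time make it smooth, and in the limit
`∫ [(v - v₀, E) + (v ⊗ v, B)] = 0` for every admissible pair (`Admissible.pairing_eq_zero`). So the
saddle functional at `v` equals `½ ∫ |v - v̄|²` whatever the admissible pair.

*Admissible pairs are transported densities.* A pair `(E, ½ (ρ - 1) I)` is admissible as soon as
`∂ₜρ = div E` and `ρ(T) = 1` (`admissible_of_continuity_equation`). Move a smooth partition of unity
on the torus backwards from time `T` along integral curves of a smooth field close to `v`: this
gives a smooth density `ρ` and a smooth `E` with `E ≈ -ρ v`, and a small constant background makes
`ρ` positive. The error `v̄ = E + ρ v` is continuous and small in `L¹`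
(`exists_admissible_density`); it only involves the modulus of continuity of `v`, because the
kernels have small support and total mass one.

With this base state `I + 2B = ρ I` and `E - v̄ = -ρ v`, so that completing the square shows that
the dual functional at `(E, B)` is minimal at `v`. Thus `(v, (E, B))` is a saddle point: both
values are `½ ∫ |v - v̄|²`, and the pair maximizes the dual objective (`duality_of_density`).
-/

noncomputable section

namespace HJDual

section

variable {p : ℕ} {F : Type*}

/-! ### The torus and its covering map -/

theorem Torus.mk_add (y z : Vec p) : Torus.mk (y + z) = Torus.mk y + Torus.mk z := by
  funext i
  simp [Torus.mk]

theorem Torus.mk_sub (y z : Vec p) : Torus.mk (y - z) = Torus.mk y - Torus.mk z := by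
  funext i
  simp [Torus.mk]

theorem Torus.mk_neg (y : Vec p) : Torus.mk (-y) = -Torus.mk y := by
  funext i
  simp [Torus.mk]

theorem Torus.mk_zero : Torus.mk (0 : Vec p) = 0 := by
  funext i
  simp [Torus.mk]

theorem Torus.mk_single (i : Fin p) (s : ℝ) :
    Torus.mk (EuclideanSpace.single i s) = Pi.single i (s : UnitAddCircle) := by
  funext j
  by_cases h : j = i
  · subst h; simp [Torus.mk]
  · simp [Torus.mk, h]

theorem Torus.isOpenQuotientMap_mk : IsOpenQuotientMap (Torus.mk : Vec p → Torus p) := by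
  have h1 : IsOpenQuotientMap (Pi.map fun (_ : Fin p) (s : ℝ) => (s : UnitAddCircle)) :=
    IsOpenQuotientMap.piMap fun _ => QuotientAddGroup.isOpenQuotientMap_mk
  exact h1.comp (PiLp.homeomorph 2 fun _ : Fin p => ℝ).isOpenQuotientMap

theorem Torus.continuous_mk : Continuous (Torus.mk : Vec p → Torus p) :=
  Torus.isOpenQuotientMap_mk.continuous

theorem Torus.surjective_mk : Function.Surjective (Torus.mk : Vec p → Torus p) :=
  Torus.isOpenQuotientMap_mk.surjective

instance : CompactSpace (Torus p) := inferInstanceAs (CompactSpace (Fin p → UnitAddCircle))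

theorem Torus.continuous_of_lift [TopologicalSpace F] {f : Torus p → F}
    (h : Continuous fun y => f (Torus.mk y)) : Continuous f :=
  Torus.isOpenQuotientMap_mk.continuous_comp_iff.1 h

/-- The covering map `[0,T] × ℝ^p → [0,T] × 𝕋^p` is a quotient map, so continuity on a time slab
may be tested on lifts. -/
theorem continuousOn_slab_iff_lift [TopologicalSpace F] {s : Set ℝ} {f : ℝ × Torus p → F} :
    ContinuousOn f (s ×ˢ univ) ↔
      ContinuousOn (fun z : ℝ × Vec p => f (z.1, Torus.mk z.2)) (s ×ˢ univ) := by
  have hq : IsOpenQuotientMap (Prod.map id Torus.mk : ℝ × Vec p → ℝ × Torus p) :=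
    IsOpenQuotientMap.id.prodMap Torus.isOpenQuotientMap_mk
  have hpre : (Prod.map id Torus.mk : ℝ × Vec p → ℝ × Torus p) ⁻¹' (s ×ˢ univ) = s ×ˢ univ := by
    ext z; simp
  have hr := hq.restrictPreimage (s ×ˢ (univ : Set (Torus p)))
  rw [continuousOn_iff_continuous_domRestrict, ← hr.continuous_comp_iff,
    continuousOn_iff_continuous_domRestrict]
  constructor
  · intro h
    exact h.comp (f := fun z : (s ×ˢ univ : Set (ℝ × Vec p)) =>
      (⟨z.1, z.2.1, trivial⟩ : (Prod.map id Torus.mk : ℝ × Vec p → ℝ × Torus p) ⁻¹'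
        (s ×ˢ univ))) (by fun_prop)
  · intro h
    exact h.comp (f := fun z : (Prod.map id Torus.mk : ℝ × Vec p → ℝ × Torus p) ⁻¹' (s ×ˢ univ) =>
      (⟨z.1, by simpa [hpre] using z.2⟩ : (s ×ˢ univ : Set (ℝ × Vec p)))) (by fun_prop)

instance : IsProbabilityMeasure (volume : Measure UnitAddCircle) :=
  ⟨by simp [AddCircle.measure_univ]⟩

instance : IsProbabilityMeasure (volume : Measure (Torus p)) :=
  inferInstanceAs
    (IsProbabilityMeasure (Measure.pi fun _ : Fin p => (volume : Measure UnitAddCircle)))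

instance (T : ℝ) : IsFiniteMeasure (spaceTime p T) := by
  unfold spaceTime; infer_instance

theorem spaceTime_eq_restrict (p : ℕ) (T : ℝ) : spaceTime p T =
    ((volume : Measure ℝ).prod (volume : Measure (Torus p))).restrict (Ioo 0 T ×ˢ univ) := by
  rw [← Measure.prod_restrict, Measure.restrict_univ]; rfl

theorem ae_spaceTime_mem (p : ℕ) (T : ℝ) : ∀ᵐ z ∂(spaceTime p T), z.1 ∈ Ioo 0 T := by
  rw [spaceTime_eq_restrict]
  filter_upwards [ae_restrict_mem (measurableSet_Ioo.prod MeasurableSet.univ)] with z hz using hz.1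

theorem measureReal_spaceTime_univ {T : ℝ} (hT : 0 < T) : (spaceTime p T).real univ = T := by
  unfold spaceTime
  rw [← univ_prod_univ, measureReal_prod_prod]
  simp [hT.le]

theorem exists_norm_bound_slab [SeminormedAddCommGroup F] {T : ℝ} {f : ℝ × Torus p → F}
    (hf : ContinuousOn f (Icc 0 T ×ˢ univ)) :
    ∃ C, 0 ≤ C ∧ ∀ t ∈ Icc 0 T, ∀ x, ‖f (t, x)‖ ≤ C := by
  obtain ⟨C, hC⟩ := (isCompact_Icc.prod isCompact_univ).exists_bound_of_continuousOn hf
  exact ⟨max C 0, le_max_right _ _,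
    fun t ht x => (hC (t, x) ⟨ht, mem_univ _⟩).trans (le_max_left _ _)⟩

theorem aestronglyMeasurable_of_continuousOn_slab [TopologicalSpace F]
    [TopologicalSpace.PseudoMetrizableSpace F] [SecondCountableTopologyEither (ℝ × Torus p) F]
    {T : ℝ} {f : ℝ × Torus p → F}
    (hf : ContinuousOn f (Ioo 0 T ×ˢ univ)) : AEStronglyMeasurable f (spaceTime p T) := by
  rw [spaceTime_eq_restrict]
  exact hf.aestronglyMeasurable (measurableSet_Ioo.prod MeasurableSet.univ)

theorem memLp_of_continuousOn_slab [NormedAddCommGroup F] {T : ℝ} {f : ℝ × Torus p → F}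
    (hf : ContinuousOn f (Icc 0 T ×ˢ univ)) (q : ℝ≥0∞) : MemLp f q (spaceTime p T) := by
  obtain ⟨C, -, hC⟩ := exists_norm_bound_slab hf
  refine MemLp.of_bound (aestronglyMeasurable_of_continuousOn_slab
    (hf.mono (prod_mono Ioo_subset_Icc_self subset_rfl))) C ?_
  filter_upwards [ae_spaceTime_mem p T] with z hz using hC z.1 (Ioo_subset_Icc_self hz) z.2

theorem integrable_of_continuousOn_slab [NormedAddCommGroup F] {T : ℝ} {f : ℝ × Torus p → F}
    (hf : ContinuousOn f (Icc 0 T ×ˢ univ)) : Integrable f (spaceTime p T) :=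
  memLp_one_iff_integrable.1 (memLp_of_continuousOn_slab hf 1)

theorem SmoothField.continuousOn [NormedAddCommGroup F] [NormedSpace ℝ F] {T : ℝ}
    {f : ℝ × Torus p → F} (hf : SmoothField T f) : ContinuousOn f (Icc 0 T ×ˢ univ) :=
  continuousOn_slab_iff_lift.2 (ContDiffOn.continuousOn hf)

/-! ### Derivatives of fields on the torus -/

theorem torusGrad_apply_of_hasFDerivAt {f : Torus p → ℝ} {y : Vec p} {f' : Vec p →L[ℝ] ℝ}
    (h : HasFDerivAt (fun w => f (Torus.mk w)) f' y) (i : Fin p) :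
    torusGrad f (Torus.mk y) i = f' (EuclideanSpace.single i 1) := by
  have h1 : HasDerivAt (fun s : ℝ => y + s • EuclideanSpace.single i (1 : ℝ))
      (EuclideanSpace.single i 1) 0 := by
    simpa using ((hasDerivAt_id (0 : ℝ)).smul_const (EuclideanSpace.single i (1 : ℝ))).const_add y
  have h2 := HasFDerivAt.comp_hasDerivAt (x := (0 : ℝ)) (l := fun w => f (Torus.mk w)) (l' := f')
    (f := fun s : ℝ => y + s • EuclideanSpace.single i (1 : ℝ)) (by simpa using h) h1
  have h3 : (fun s : ℝ => f (Torus.mk y + Pi.single i (s : UnitAddCircle)))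
      = (fun w => f (Torus.mk w)) ∘ fun s : ℝ => y + s • EuclideanSpace.single i (1 : ℝ) := by
    funext s
    have h4 : s • EuclideanSpace.single i (1 : ℝ) = EuclideanSpace.single i s := by
      ext j
      by_cases hj : j = i <;> simp [hj]
    simp [Torus.mk_add, ← Torus.mk_single, h4]
  simp only [torusGrad]
  rw [h3, h2.deriv]

theorem torusGrad_of_hasGradientAt {f : Torus p → ℝ} {y g : Vec p}
    (h : HasGradientAt (fun w => f (Torus.mk w)) g y) : torusGrad f (Torus.mk y) = g := by
  ext i
  rw [torusGrad_apply_of_hasFDerivAt h.hasFDerivAt i]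
  simp [InnerProductSpace.toDual_apply_apply, EuclideanSpace.inner_single_right]

theorem torusGrad_eq_gradient {f : Torus p → ℝ} {y : Vec p}
    (h : DifferentiableAt ℝ (fun w => f (Torus.mk w)) y) :
    torusGrad f (Torus.mk y) = ∇ (fun w => f (Torus.mk w)) y :=
  torusGrad_of_hasGradientAt h.hasGradientAt

theorem inner_torusGrad {f : Torus p → ℝ} {y : Vec p} {f' : Vec p →L[ℝ] ℝ}
    (h : HasFDerivAt (fun w => f (Torus.mk w)) f' y) (e : Vec p) :
    inner ℝ e (torusGrad f (Torus.mk y)) = f' e := by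
  rw [torusGrad_eq_gradient h.differentiableAt, real_inner_comm, inner_gradient_left, h.fderiv]

/-- The time derivative of a smooth field extends to a function `h` continuous up to the end points,
the spatial gradient is continuous there too, and the chain rule holds along the translates of a
curve. The field `h` is the one-sided derivative within `[0,T]`, since the two-sided one has junk
values at the end points. -/
theorem SmoothField.exists_timeDeriv {T : ℝ} (hT : 0 < T) {g : ℝ × Torus p → ℝ}
    (hg : SmoothField T g) :
    ∃ h : ℝ × Torus p → ℝ, ContinuousOn h (Icc 0 T ×ˢ univ) ∧
      ContinuousOn (fun z => torusGrad (fun x => g (z.1, x)) z.2) (Icc 0 T ×ˢ univ) ∧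
      (∀ t ∈ Ioo 0 T, ∀ x, HasDerivAt (fun s => g (s, x)) (h (t, x)) t) ∧
      ∀ t ∈ Ioo 0 T, ∀ (y : Vec p) (X : ℝ → Vec p) (V : Vec p), HasDerivAt X V t →
        HasDerivAt (fun s => g (s, Torus.mk (y + X s)))
          (h (t, Torus.mk (y + X t)) +
            inner ℝ V (torusGrad (fun x => g (t, x)) (Torus.mk (y + X t)))) t := by
  set G : ℝ × Vec p → ℝ := fun z => g (z.1, Torus.mk z.2) with hG
  set S : Set (ℝ × Vec p) := Icc 0 T ×ˢ univ with hS
  have hu : UniqueDiffOn ℝ S := (uniqueDiffOn_Icc hT).prod uniqueDiffOn_univ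
  set D := fderivWithin ℝ G S with hD
  have hDc : ContinuousOn D S := ContDiffOn.continuousOn_fderivWithin hg hu (by simp)
  have hdw : ∀ t ∈ Icc 0 T, ∀ y, HasFDerivWithinAt G (D (t, y)) S (t, y) := fun t ht y =>
    (ContDiffOn.differentiableOn hg (by simp) (t, y) ⟨ht, mem_univ _⟩).hasFDerivWithinAt
  have hd : ∀ t ∈ Ioo 0 T, ∀ y, HasFDerivAt G (D (t, y)) (t, y) := fun t ht y =>
    (hdw t (Ioo_subset_Icc_self ht) y).hasFDerivAt
      (prod_mem_nhds (Icc_mem_nhds ht.1 ht.2) univ_mem)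
  have htime : ∀ t ∈ Icc 0 T, ∀ y, derivWithin (fun s => g (s, Torus.mk y)) (Icc 0 T) t
      = D (t, y) (1, 0) := by
    intro t ht y
    have h1 : HasDerivWithinAt (fun s : ℝ => (s, y)) ((1 : ℝ), (0 : Vec p)) (Icc 0 T) t :=
      ((hasDerivAt_id t).prodMk (hasDerivAt_const t y)).hasDerivWithinAt
    have h2 : MapsTo (fun s : ℝ => (s, y)) (Icc 0 T) S := fun s hs => ⟨hs, mem_univ _⟩
    exact ((hdw t ht y).comp_hasDerivWithinAt t h1 h2).derivWithin
      (uniqueDiffOn_Icc hT t ht)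
  have hspace : ∀ t ∈ Icc 0 T, ∀ y, HasFDerivAt (fun w => g (t, Torus.mk w))
      ((D (t, y)).comp (ContinuousLinearMap.inr ℝ ℝ (Vec p))) y := by
    intro t ht y
    rw [← hasFDerivWithinAt_univ]
    exact (hdw t ht y).comp (f := fun w : Vec p => (t, w)) y
      (hasFDerivAt_prodMk_right t y).hasFDerivWithinAt (
      fun w _ => ⟨ht, mem_univ _⟩)
  refine ⟨fun z => derivWithin (fun s => g (s, z.2)) (Icc 0 T) z.1, ?_, ?_, ?_, ?_⟩
  · refine continuousOn_slab_iff_lift.2 ?_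
    refine (hDc.clm_apply (continuousOn_const (c := ((1 : ℝ), (0 : Vec p))))).congr ?_
    rintro ⟨t, y⟩ ⟨ht, -⟩
    exact htime t ht y
  · refine continuousOn_slab_iff_lift.2 ?_
    have h1 : ContinuousOn (fun z : ℝ × Vec p => fun i : Fin p =>
        D z ((0 : ℝ), EuclideanSpace.single i (1 : ℝ))) S :=
      continuousOn_pi.2 fun i => hDc.clm_apply continuousOn_const
    refine ((PiLp.continuous_toLp 2 _).comp_continuousOn h1).congr ?_
    rintro ⟨t, y⟩ ⟨ht, -⟩
    ext i
    exact torusGrad_apply_of_hasFDerivAt (f := fun x => g (t, x)) (hspace t ht y) i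
  · intro t ht x
    obtain ⟨y, rfl⟩ := Torus.surjective_mk x
    have h1 : HasDerivAt (fun s : ℝ => (s, y)) ((1 : ℝ), (0 : Vec p)) t :=
      (hasDerivAt_id t).prodMk (hasDerivAt_const t y)
    simp only [htime t (Ioo_subset_Icc_self ht) y]
    exact (hd t ht y).comp_hasDerivAt t h1
  · intro t ht y X V hX
    have h1 : HasDerivAt (fun s : ℝ => (s, y + X s)) ((1 : ℝ), V) t :=
      (hasDerivAt_id t).prodMk (hX.const_add y)
    have h2 := (hd t ht (y + X t)).comp_hasDerivAt t h1
    have h3 := inner_torusGrad (f := fun x => g (t, x))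
      (hspace t (Ioo_subset_Icc_self ht) (y + X t)) V
    have h4 : D (t, y + X t) (1, V) = D (t, y + X t) (1, 0) + D (t, y + X t) (0, V) := by
      rw [← map_add]; simp
    simp only [htime t (Ioo_subset_Icc_self ht), h3]
    rw [h4] at h2
    exact h2

end

section

variable {p : ℕ}

/-! ### The Hamilton-Jacobi equation along the time lines -/

/-- Viscosity subsolutions of `∂ₜψ + ½ σ |∇ψ|² ≤ 0` with a continuous spatial gradient `v` satisfy
the integrated inequality along each line `{x} × [0,T]`. The test functions are
`θ(t) + n |y - y₀|²`: as the penalization `n` grows the touching points approach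
the line, and there the gradient of the test function is the value of `v`. -/
theorem viscosity_sub_along_time {T σ : ℝ} {ψ : ℝ × Torus p → ℝ} {v : ℝ × Torus p → Vec p}
    (hψ : ContinuousOn ψ (Icc 0 T ×ˢ univ)) (hv : ContinuousOn v (Icc 0 T ×ˢ univ))
    (hgrad : ∀ t ∈ Icc 0 T, IsTorusGradient (fun x => ψ (t, x)) (fun x => v (t, x)))
    (hsub : ∀ φ : ℝ × Vec p → ℝ, ContDiff ℝ 1 φ → ∀ t ∈ Ioo 0 T, ∀ y : Vec p,
      IsLocalMax (fun z : ℝ × Vec p => ψ (z.1, Torus.mk z.2) - φ z) (t, y) →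
        deriv (fun s => φ (s, y)) t + σ / 2 * ‖∇ (fun w => φ (t, w)) y‖ ^ 2 ≤ 0)
    {b : ℝ} (hb : 0 ≤ b) (hbT : b < T) (y₀ : Vec p) :
    ψ (b, Torus.mk y₀) ≤ ψ (0, Torus.mk y₀)
      + ∫ s in 0..b, -(σ / 2) * ‖v (s, Torus.mk y₀)‖ ^ 2 := by
  rcases hb.eq_or_lt with rfl | hb0
  · simp
  have hT : 0 < T := hb0.trans hbT
  -- a continuous extension of the right-hand side to all times
  set g : ℝ → ℝ := fun s => -(σ / 2) * ‖v (projIcc 0 T hT.le s, Torus.mk y₀)‖ ^ 2 with hg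
  have hgc : Continuous g := by
    have h1 : Continuous fun s : ℝ => v (projIcc 0 T hT.le s, Torus.mk y₀) :=
      hv.comp_continuous (by fun_prop) fun s => ⟨(projIcc 0 T hT.le s).2, mem_univ _⟩
    exact continuous_const.mul (h1.norm.pow 2)
  have hgeq : ∀ s ∈ Icc 0 T, g s = -(σ / 2) * ‖v (s, Torus.mk y₀)‖ ^ 2 := fun s hs => by
    simp [hg, projIcc_of_mem hT.le hs]
  have hint : ∫ s in 0..b, -(σ / 2) * ‖v (s, Torus.mk y₀)‖ ^ 2 = ∫ s in 0..b, g s := by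
    refine intervalIntegral.integral_congr fun s hs => ?_
    rw [uIcc_of_le hb] at hs
    exact (hgeq s ⟨hs.1, hs.2.trans hbT.le⟩).symm
  rw [hint]
  by_contra! hcon
  -- a test function with slope exceeding the right-hand side by `c > 0` still leaves room at `b`
  set c := (ψ (b, Torus.mk y₀) - ψ (0, Torus.mk y₀) - ∫ s in 0..b, g s) / (2 * b) with hc
  have hc0 : 0 < c := by rw [hc]; apply div_pos <;> linarith
  have hcb : c * b = (ψ (b, Torus.mk y₀) - ψ (0, Torus.mk y₀) - ∫ s in 0..b, g s) / 2 := by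
    rw [hc]; field_simp
  -- the barrier `R` pushes the maximum away from the final time
  set θ₀ : ℝ → ℝ := fun t => (∫ s in 0..t, g s) + c * t with hθ₀
  set R : ℝ := max 0 (ψ (T, Torus.mk y₀) - ψ (b, Torus.mk y₀) + θ₀ b - θ₀ T + 1) with hR
  set θ : ℝ → ℝ := fun t => θ₀ t + R * Real.smoothTransition ((t - b) / (T - b)) with hθ
  have hTb : 0 < T - b := sub_pos.2 hbT
  have hθ₀d : ∀ t, HasDerivAt θ₀ (g t + c) t := fun t => by
    have h1 := intervalIntegral.integral_hasDerivAt_right (hgc.intervalIntegrable 0 t)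
      hgc.stronglyMeasurable.stronglyMeasurableAtFilter hgc.continuousAt
    exact (h1.add ((hasDerivAt_id t).const_mul c)).congr_deriv (by simp)
  have hθ₀C : ContDiff ℝ 1 θ₀ := by
    rw [contDiff_one_iff_deriv]
    refine ⟨fun t => (hθ₀d t).differentiableAt, ?_⟩
    rw [show deriv θ₀ = fun t => g t + c from funext fun t => (hθ₀d t).deriv]
    fun_prop
  have hstC : ContDiff ℝ 1 fun t : ℝ => R * Real.smoothTransition ((t - b) / (T - b)) :=
    contDiff_const.mul ((Real.smoothTransition.contDiff (n := 1)).comp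
      ((contDiff_id.sub contDiff_const).div_const _))
  have hθC : ContDiff ℝ 1 θ := hθ₀C.add hstC
  have hθd : ∀ t, g t + c ≤ deriv θ t := by
    intro t
    have hmono : Monotone fun t : ℝ => R * Real.smoothTransition ((t - b) / (T - b)) := by
      intro s t hst
      refine mul_le_mul_of_nonneg_left (Real.smoothTransition.monotone ?_) (le_max_left _ _)
      gcongr
    have h1 := hmono.deriv_nonneg (x := t)
    have h2 : deriv θ t = (g t + c) + deriv (fun t : ℝ => R * Real.smoothTransition
        ((t - b) / (T - b))) t :=
      ((hθ₀d t).add ((hstC.differentiable (by simp)) t).hasDerivAt).deriv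
    linarith
  have hθ0 : θ 0 = 0 := by
    have : Real.smoothTransition ((0 - b) / (T - b)) = 0 :=
      Real.smoothTransition.zero_of_nonpos (div_nonpos_of_nonpos_of_nonneg (by linarith) hTb.le)
    simp only [hθ, hθ₀, this]
    simp
  have hθb : θ b = (∫ s in 0..b, g s) + c * b := by simp [hθ, hθ₀]
  have hθT : θ T = θ₀ T + R := by simp [hθ, div_self hTb.ne']
  set q : ℝ × Vec p → ℝ := fun z => ψ (z.1, Torus.mk z.2) - θ z.1 with hq
  have hq0 : q (0, y₀) < q (b, y₀) := by
    simp only [hq, hθ0, hθb]; linarith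
  have hqT : q (T, y₀) < q (b, y₀) := by
    have : R ≥ ψ (T, Torus.mk y₀) - ψ (b, Torus.mk y₀) + θ₀ b - θ₀ T + 1 := le_max_right _ _
    have h2 : θ b = θ₀ b := hθb
    simp only [hq, hθT, h2]; linarith
  set S : Set (ℝ × Vec p) := Icc 0 T ×ˢ Metric.closedBall y₀ 1 with hS
  have hSc : IsCompact S := isCompact_Icc.prod (isCompact_closedBall _ _)
  have hψl := (continuousOn_slab_iff_lift.1 hψ).mono (prod_mono subset_rfl (subset_univ
    (Metric.closedBall y₀ 1)))
  have hvl := (continuousOn_slab_iff_lift.1 hv).mono (prod_mono subset_rfl (subset_univ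
    (Metric.closedBall y₀ 1)))
  have hqc : ContinuousOn q S := hψl.sub (hθC.continuous.comp continuous_fst).continuousOn
  have hwc : ContinuousOn (fun z : ℝ × Vec p => σ / 2 * ‖v (z.1, Torus.mk z.2)‖ ^ 2) S :=
    continuousOn_const.mul (hvl.norm.pow 2)
  obtain ⟨C, hC⟩ := hSc.exists_bound_of_continuousOn hqc
  have hqu := Metric.uniformContinuousOn_iff.1 (hSc.uniformContinuousOn_of_continuous hqc)
    (min (q (b, y₀) - q (0, y₀)) (q (b, y₀) - q (T, y₀))) (lt_min (by linarith) (by linarith))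
  have hwu := Metric.uniformContinuousOn_iff.1 (hSc.uniformContinuousOn_of_continuous hwc) c hc0
  obtain ⟨δ₁, hδ₁, hq1⟩ := hqu
  obtain ⟨δ₂, hδ₂, hw1⟩ := hwu
  set δ := min (min δ₁ δ₂) 1 with hδ
  have hδ0 : 0 < δ := lt_min (lt_min hδ₁ hδ₂) one_pos
  -- a penalization large enough to keep the maximum within `δ` of the line
  obtain ⟨n, hn⟩ := exists_nat_gt (2 * C / δ ^ 2)
  have hn' : 2 * C < n * δ ^ 2 := by rwa [div_lt_iff₀ (by positivity)] at hn
  have hy₀S : ∀ t ∈ Icc 0 T, (t, y₀) ∈ S := fun t ht => ⟨ht, Metric.mem_closedBall_self zero_le_one⟩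
  have hbI : b ∈ Icc 0 T := ⟨hb, hbT.le⟩
  obtain ⟨⟨t, y⟩, htyS, hmax⟩ := hSc.exists_isMaxOn ⟨_, hy₀S b hbI⟩
    (f := fun z => q z - n * ‖z.2 - y₀‖ ^ 2) (hqc.sub (by fun_prop))
  have hmaxb : q (b, y₀) ≤ q (t, y) - n * ‖y - y₀‖ ^ 2 := by
    simpa using hmax (hy₀S b hbI)
  have hyδ : ‖y - y₀‖ < δ := by
    have h1 := hC _ htyS
    have h2 := hC _ (hy₀S b hbI)
    rw [Real.norm_eq_abs, abs_le] at h1 h2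
    have h3 : (n : ℝ) * ‖y - y₀‖ ^ 2 < n * δ ^ 2 := by linarith
    by_contra! h4
    have : δ ^ 2 ≤ ‖y - y₀‖ ^ 2 := by gcongr
    have := mul_le_mul_of_nonneg_left this (Nat.cast_nonneg (α := ℝ) n)
    linarith
  have hdist : ∀ s : ℝ, dist ((s, y) : ℝ × Vec p) (s, y₀) < δ := fun s => by
    simpa [Prod.dist_eq, dist_eq_norm, hδ0] using hyδ
  have hqle : q (b, y₀) ≤ q (t, y) := by
    have : (0 : ℝ) ≤ n * ‖y - y₀‖ ^ 2 := by positivity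
    linarith
  have hδ1' : δ ≤ δ₁ := (min_le_left _ _).trans (min_le_left _ _)
  have hδ2' : δ ≤ δ₂ := (min_le_left _ _).trans (min_le_right _ _)
  have hclose := hq1 _ htyS _ (hy₀S t htyS.1) ((hdist t).trans_le hδ1')
  rw [Real.dist_eq, abs_lt, lt_min_iff] at hclose
  have ht0 : t ≠ 0 := by
    rintro rfl
    linarith [hclose.2.1]
  have htT : t ≠ T := by
    rintro rfl
    linarith [hclose.2.2]
  have htI : t ∈ Ioo 0 T := ⟨htyS.1.1.lt_of_ne' ht0, htyS.1.2.lt_of_ne htT⟩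
  have hSn : S ∈ 𝓝 (t, y) := prod_mem_nhds (Icc_mem_nhds htI.1 htI.2)
    (Metric.closedBall_mem_nhds_of_mem (by
      rw [Metric.mem_ball, dist_eq_norm]; exact hyδ.trans_le (min_le_right _ _)))
  set φ : ℝ × Vec p → ℝ := fun z => θ z.1 + n * ‖z.2 - y₀‖ ^ 2 with hφ
  have hφC : ContDiff ℝ 1 φ :=
    (hθC.comp contDiff_fst).add (contDiff_const.mul ((contDiff_snd.sub contDiff_const).norm_sq ℝ))
  have hloc : IsLocalMax (fun z : ℝ × Vec p => ψ (z.1, Torus.mk z.2) - φ z) (t, y) := by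
    have := hmax.isLocalMax hSn
    refine this.congr (Eventually.of_forall fun z => ?_)
    simp only [hq, hφ]; ring
  have hvisc := hsub φ hφC t htI y hloc
  have hdt : deriv (fun s => φ (s, y)) t = deriv θ t := by
    simp [hφ]
  -- the spatial slices also touch, and `ψ` is differentiable in space
  have hgr : ∇ (fun w => φ (t, w)) y = v (t, Torus.mk y) := by
    have h1 : DifferentiableAt ℝ (fun w => φ (t, w)) y :=
      (hφC.comp (contDiff_prodMk_right t)).differentiable (by simp) y
    have h2 := hgrad t (Ioo_subset_Icc_self htI) y
    have h3 : IsLocalMax (fun w => ψ (t, Torus.mk w) - φ (t, w)) y := by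
      have : Tendsto (fun w : Vec p => (t, w)) (𝓝 y) (𝓝 (t, y)) := by
        exact (Continuous.prodMk_right t).continuousAt
      exact this.eventually hloc
    have h4 := h3.hasFDerivAt_eq_zero (h2.hasFDerivAt.sub h1.hasGradientAt.hasFDerivAt)
    rw [← map_sub, LinearIsometryEquiv.map_eq_zero_iff, sub_eq_zero] at h4
    exact h4.symm
  rw [hdt, hgr] at hvisc
  have hd := hθd t
  rw [hgeq t htyS.1] at hd
  have hw := hw1 _ htyS _ (hy₀S t htyS.1) ((hdist t).trans_le hδ2')
  rw [Real.dist_eq, abs_lt] at hw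
  linarith [hw.1]

/-- A viscosity solution with continuous spatial gradient satisfies the equation in integrated
form: `ψ(t,x) = ψ⋆(x) - ½ ∫₀ᵗ |v(s,x)|² ds`. -/
theorem IsViscositySolution.integral_eq {T : ℝ} (hT : 0 < T) {ψs : Torus p → ℝ}
    {ψ : ℝ × Torus p → ℝ} {v : ℝ × Torus p → Vec p} (hψ : IsViscositySolution T ψs ψ)
    (hv : ContinuousOn v (Icc 0 T ×ˢ univ))
    (hgrad : ∀ t ∈ Icc 0 T, IsTorusGradient (fun x => ψ (t, x)) (fun x => v (t, x)))
    {t : ℝ} (ht : t ∈ Icc 0 T) (x : Torus p) :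
    ψ (t, x) = ψs x - (1 / 2) * ∫ s in 0..t, ‖v (s, x)‖ ^ 2 := by
  obtain ⟨y, rfl⟩ := Torus.surjective_mk x
  have hlt : ∀ b ∈ Ico 0 T, ψ (b, Torus.mk y) = ψs (Torus.mk y)
      - (1 / 2) * ∫ s in 0..b, ‖v (s, Torus.mk y)‖ ^ 2 := by
    intro b hb
    have h1 := viscosity_sub_along_time (σ := 1) hψ.continuousOn hv hgrad
      (by simpa using hψ.subsolution) hb.1 hb.2 y
    have h2 := viscosity_sub_along_time (σ := -1) (ψ := fun z => -ψ z) (v := fun z => -v z)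
      hψ.continuousOn.neg hv.neg (fun t ht y => by
        have := (hgrad t ht y).hasFDerivAt.neg
        rw [hasGradientAt_iff_hasFDerivAt, map_neg]
        exact this) ?_ hb.1 hb.2 y
    · rw [intervalIntegral.integral_const_mul] at h1 h2
      simp only [norm_neg] at h2
      rw [← hψ.initial]
      linarith
    · intro φ hφ t ht y hloc
      have h3 := hψ.supersolution (fun z => -φ z) hφ.neg t ht y (by
        refine hloc.neg.congr (Eventually.of_forall fun z => ?_)
        ring)
      have h4 : ∇ (fun w => -φ (t, w)) y = -∇ (fun w => φ (t, w)) y := by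
        have h1 : DifferentiableAt ℝ (fun w => φ (t, w)) y :=
          (hφ.comp (contDiff_prodMk_right t)).differentiable (by simp) y
        refine HasGradientAt.gradient ?_
        rw [hasGradientAt_iff_hasFDerivAt, map_neg]
        exact h1.hasGradientAt.hasFDerivAt.neg
      have h5 : deriv (fun s => -φ (s, y)) t = -deriv (fun s => φ (s, y)) t := deriv.fun_neg
      rw [h4, h5, norm_neg] at h3
      linarith
  have hvy : ContinuousOn (fun s => ‖v (s, Torus.mk y)‖ ^ 2) (Icc 0 T) :=
    (hv.comp (by fun_prop) fun s hs => ⟨hs, mem_univ _⟩ : ContinuousOn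
      (fun s => v (s, Torus.mk y)) (Icc 0 T)).norm.pow 2
  have hcl : EqOn (fun t => ψ (t, Torus.mk y)) (fun t => ψs (Torus.mk y)
      - (1 / 2) * ∫ s in 0..t, ‖v (s, Torus.mk y)‖ ^ 2) (Icc 0 T) := by
    refine EqOn.of_subset_closure (s := Ico 0 T) hlt
      (hψ.continuousOn.comp (by fun_prop) fun s hs => ⟨hs, mem_univ _⟩) ?_ Ico_subset_Icc_self
      (closure_Ico hT.ne).ge
    refine continuousOn_const.sub (continuousOn_const.mul ?_)
    have := intervalIntegral.continuousOn_primitive_interval' (μ := volume)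
      (a := 0) (b₁ := 0) (b₂ := T) (hvy.intervalIntegrable_of_Icc hT.le) (by simp)
    rwa [uIcc_of_le hT.le] at this
  exact hcl ht

end

section

variable {p : ℕ} {F : Type*} [NormedAddCommGroup F] [NormedSpace ℝ F]

/-! ### Mollification on the torus -/

/-- The mollification of a function on the torus by a normalized bump function on `ℝ^p`. Its lift
to `ℝ^p` is the usual convolution with the lift of `f`. -/
def moll (φ : ContDiffBump (0 : Vec p)) (f : Torus p → F) (x : Torus p) : F :=
  ∫ s, φ.normed volume s • f (x - Torus.mk s)

theorem moll_mk (φ : ContDiffBump (0 : Vec p)) (f : Torus p → F) :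
    (fun y => moll φ f (Torus.mk y)) = MeasureTheory.convolution (φ.normed volume)
      (fun w => f (Torus.mk w)) (ContinuousLinearMap.lsmul ℝ ℝ) volume := by
  funext y
  simp [moll, MeasureTheory.convolution, Torus.mk_sub]

theorem contDiff_moll [CompleteSpace F] (φ : ContDiffBump (0 : Vec p)) {f : Torus p → F}
    (hf : Continuous f) : ContDiff ℝ ∞ fun y => moll φ f (Torus.mk y) := by
  rw [moll_mk]
  exact φ.hasCompactSupport_normed.contDiff_convolution_left _ φ.contDiff_normed
    (hf.comp Torus.continuous_mk).locallyIntegrable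

theorem continuous_moll [CompleteSpace F] (φ : ContDiffBump (0 : Vec p)) {f : Torus p → F}
    (hf : Continuous f) : Continuous (moll φ f) :=
  Torus.continuous_of_lift (contDiff_moll φ hf).continuous

theorem integrable_moll (φ : ContDiffBump (0 : Vec p)) {f : Torus p → F} (hf : Continuous f)
    (x : Torus p) : Integrable fun s => φ.normed volume s • f (x - Torus.mk s) := by
  refine Continuous.integrable_of_hasCompactSupport ?_ φ.hasCompactSupport_normed.smul_right
  exact φ.continuous_normed.smul (hf.comp (continuous_const.sub Torus.continuous_mk))

theorem moll_sub (φ : ContDiffBump (0 : Vec p)) {f g : Torus p → F} (hf : Continuous f)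
    (hg : Continuous g) (x : Torus p) :
    moll φ (fun y => f y - g y) x = moll φ f x - moll φ g x := by
  simp only [moll, smul_sub]
  exact integral_sub (integrable_moll φ hf x) (integrable_moll φ hg x)

theorem moll_const_smul (φ : ContDiffBump (0 : Vec p)) (f : Torus p → F) (c : ℝ) (x : Torus p) :
    moll φ (fun y => c • f y) x = c • moll φ f x := by
  simp only [moll, smul_comm _ c]
  exact integral_smul c _

theorem moll_sum {ι : Type*} (φ : ContDiffBump (0 : Vec p)) (s : Finset ι) {f : ι → Torus p → F}
    (hf : ∀ i ∈ s, Continuous (f i)) (x : Torus p) :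
    moll φ (fun y => ∑ i ∈ s, f i y) x = ∑ i ∈ s, moll φ (f i) x := by
  simp only [moll, Finset.smul_sum]
  exact integral_finsetSum s fun i hi => integrable_moll φ (hf i hi) x

theorem norm_moll_le (φ : ContDiffBump (0 : Vec p)) {f : Torus p → F} {C : ℝ}
    (hC : ∀ x, ‖f x‖ ≤ C) (x : Torus p) : ‖moll φ f x‖ ≤ C := by
  have h : ‖moll φ f x‖ ≤ ∫ s, φ.normed volume s * C := by
    refine norm_integral_le_of_norm_le (φ.integrable_normed.mul_const C)
      (Eventually.of_forall fun s => ?_)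
    rw [norm_smul, Real.norm_of_nonneg (φ.nonneg_normed s)]
    exact mul_le_mul_of_nonneg_left (hC _) (φ.nonneg_normed s)
  rwa [integral_mul_const, φ.integral_normed, one_mul] at h

theorem dist_moll_le [CompleteSpace F] (φ : ContDiffBump (0 : Vec p)) {f : Torus p → F}
    (hf : Continuous f) {ε : ℝ} {x : Torus p}
    (h : ∀ s : Vec p, ‖s‖ < φ.rOut → ‖f (x - Torus.mk s) - f x‖ ≤ ε) :
    ‖moll φ f x - f x‖ ≤ ε := by
  obtain ⟨y, rfl⟩ := Torus.surjective_mk x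
  have := φ.dist_normed_convolution_le (μ := volume) (x₀ := y) (ε := ε)
    (g := fun w => f (Torus.mk w)) (hf.comp Torus.continuous_mk).aestronglyMeasurable (by
      intro w hw
      rw [Metric.mem_ball, dist_comm, dist_eq_norm] at hw
      have := h (y - w) hw
      rwa [Torus.mk_sub, sub_sub_cancel, ← dist_eq_norm] at this)
  rw [← moll_mk, dist_eq_norm] at this
  exact this

/-- For a fixed bump, the gradient of the mollification is controlled by the sup norm. -/
theorem exists_norm_torusGrad_moll_le (φ : ContDiffBump (0 : Vec p)) :
    ∃ C, 0 ≤ C ∧ ∀ f : Torus p → ℝ, Continuous f → ∀ M, (∀ x, |f x| ≤ M) →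
      ∀ x, ‖torusGrad (moll φ f) x‖ ≤ C * M := by
  refine ⟨∫ s, ‖fderiv ℝ (φ.normed volume) s‖, integral_nonneg fun s => norm_nonneg _, ?_⟩
  intro f hf M hM x
  obtain ⟨y, rfl⟩ := Torus.surjective_mk x
  have hC1 : ContDiff ℝ 1 (φ.normed (volume : Measure (Vec p))) := φ.contDiff_normed
  have hd := φ.hasCompactSupport_normed.hasFDerivAt_convolution_left (μ := volume)
    (ContinuousLinearMap.lsmul ℝ ℝ) hC1
    (hf.comp Torus.continuous_mk).locallyIntegrable y
  have hm := moll_mk φ f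
  have hd' : HasFDerivAt (fun y => moll φ f (Torus.mk y)) _ y := hm ▸ hd
  rw [torusGrad_eq_gradient hd'.differentiableAt, gradient, hd'.fderiv,
    LinearIsometryEquiv.norm_map, ← integral_mul_const]
  have hint : Integrable (fun s => ‖fderiv ℝ (φ.normed (volume : Measure (Vec p))) s‖) := by
    refine Continuous.integrable_of_hasCompactSupport (hC1.continuous_fderiv (by simp)).norm ?_
    exact (φ.hasCompactSupport_normed.fderiv ℝ).norm
  refine norm_integral_le_of_norm_le (hint.mul_const M) (Eventually.of_forall fun s => ?_)
  refine ContinuousLinearMap.opNorm_le_bound _ ?_ fun e => ?_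
  · exact mul_nonneg (norm_nonneg _) ((abs_nonneg _).trans (hM 0))
  · simp only [ContinuousLinearMap.precompL_apply, ContinuousLinearMap.lsmul_apply, smul_eq_mul,
      norm_mul, Function.comp]
    rw [mul_right_comm]
    exact mul_le_mul (ContinuousLinearMap.le_opNorm _ _) (hM _) (norm_nonneg _) (by positivity)

/-- Mollification commutes with the gradient of a `C¹` function. -/
theorem IsTorusGradient.moll (φ : ContDiffBump (0 : Vec p)) {f : Torus p → ℝ}
    {g : Torus p → Vec p} (h : IsTorusGradient f g) (hg : Continuous g) :
    IsTorusGradient (HJDual.moll φ f) (HJDual.moll φ g) := by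
  intro y
  have hf : Continuous f := Torus.continuous_of_lift
    (continuous_iff_continuousAt.2 fun w => (h w).hasFDerivAt.continuousAt)
  obtain ⟨C, hC⟩ := isCompact_univ.exists_bound_of_continuousOn (f := g) hg.continuousOn
  have key := hasFDerivAt_integral_of_dominated_of_fderiv_le (μ := (volume : Measure (Vec p)))
    (F := fun w s => φ.normed volume s • f (Torus.mk w - Torus.mk s))
    (F' := fun w s => φ.normed volume s •
      InnerProductSpace.toDual ℝ (Vec p) (g (Torus.mk w - Torus.mk s)))
    (x₀ := y) (s := univ) (bound := fun s => φ.normed volume s * C) univ_mem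
    (Eventually.of_forall fun w => (integrable_moll φ hf _).aestronglyMeasurable)
    (integrable_moll φ hf _)
    (integrable_moll φ (f := fun x => InnerProductSpace.toDual ℝ (Vec p) (g x))
      ((InnerProductSpace.toDual ℝ (Vec p)).continuous.comp hg) _).aestronglyMeasurable
    (Eventually.of_forall fun s w _ => by
      rw [norm_smul, LinearIsometryEquiv.norm_map, Real.norm_of_nonneg (φ.nonneg_normed s)]
      exact mul_le_mul_of_nonneg_left (hC _ (mem_univ _)) (φ.nonneg_normed s))
    (φ.integrable_normed.mul_const C)
    (Eventually.of_forall fun s w _ => by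
      have h1 := (hasFDerivAt_comp_sub s).2 (h (w - s)).hasFDerivAt
      simp only [Torus.mk_sub] at h1
      exact h1.const_smul (φ.normed volume s))
  have h2 := (InnerProductSpace.toDual ℝ (Vec p)).toContinuousLinearEquiv.integral_comp_comm
    (μ := volume) (fun s => φ.normed volume s • g (Torus.mk y - Torus.mk s))
  have h3 : InnerProductSpace.toDual ℝ (Vec p) (HJDual.moll φ g (Torus.mk y)) =
      ∫ s, φ.normed volume s •
        InnerProductSpace.toDual ℝ (Vec p) (g (Torus.mk y - Torus.mk s)) := by
    simpa [HJDual.moll] using h2.symm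
  rw [hasGradientAt_iff_hasFDerivAt, h3]
  exact key

theorem exists_unif_slab {G : Type*} [NormedAddCommGroup G] {T : ℝ} {f : ℝ × Torus p → G}
    (hf : ContinuousOn f (Icc 0 T ×ˢ univ)) {ε : ℝ} (hε : 0 < ε) :
    ∃ r > 0, ∀ t ∈ Icc 0 T, ∀ x, ∀ s : Vec p, ‖s‖ < r →
      ‖f (t, x + Torus.mk s) - f (t, x)‖ ≤ ε := by
  have hu := (isCompact_Icc.prod isCompact_univ).uniformContinuousOn_of_continuous hf
  obtain ⟨δ, hδ, h⟩ := Metric.uniformContinuousOn_iff.1 hu ε hε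
  have hc := Metric.continuousAt_iff.1 
    ((Torus.continuous_mk (p := p)).continuousAt (x := 0)) δ hδ
  obtain ⟨r, hr, hr'⟩ := hc
  refine ⟨r, hr, fun t ht x s hs => ?_⟩
  rw [← dist_eq_norm]
  refine (h _ ⟨ht, mem_univ _⟩ _ ⟨ht, mem_univ _⟩ ?_).le
  have := hr' (x := s) (by simpa using hs)
  simpa [Prod.dist_eq, hδ, Torus.mk_zero] using this

theorem continuous_slice {X : Type*} [TopologicalSpace X] {T : ℝ} {f : ℝ × Torus p → X}
    (hf : ContinuousOn f (Icc 0 T ×ˢ univ)) {t : ℝ} (ht : t ∈ Icc 0 T) :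
    Continuous fun x => f (t, x) :=
  hf.comp_continuous (by fun_prop) fun x => ⟨ht, mem_univ x⟩

theorem continuousOn_moll [CompleteSpace F] (φ : ContDiffBump (0 : Vec p)) {T : ℝ}
    {f : ℝ × Torus p → F} (hf : ContinuousOn f (Icc 0 T ×ˢ univ)) :
    ContinuousOn (fun z : ℝ × Torus p => moll φ (fun x => f (z.1, x)) z.2) (Icc 0 T ×ˢ univ) := by
  obtain ⟨C, -, hC⟩ := exists_norm_bound_slab hf
  rw [continuousOn_iff_continuous_domRestrict]
  refine continuous_of_dominated (bound := fun s => φ.normed volume s * C) ?_ ?_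
    (φ.integrable_normed.mul_const C) ?_
  · rintro ⟨⟨t, x⟩, ht, -⟩
    exact (integrable_moll φ (continuous_slice hf ht) x).aestronglyMeasurable
  · rintro ⟨⟨t, x⟩, ht, -⟩
    refine Eventually.of_forall fun s => ?_
    rw [norm_smul, Real.norm_of_nonneg (φ.nonneg_normed s)]
    exact mul_le_mul_of_nonneg_left (hC t ht _) (φ.nonneg_normed s)
  · refine Eventually.of_forall fun s => continuous_const.smul ?_
    exact hf.comp_continuous (f := fun z : (Icc 0 T ×ˢ univ : Set (ℝ × Torus p)) =>
      (z.1.1, z.1.2 - Torus.mk s)) (by fun_prop) fun z => ⟨z.2.1, mem_univ _⟩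

/-- A continuous field on the slab is a uniform limit of finite sums `∑ₖ bₖ(t) f(τₖ, x)` with smooth
`bₖ`: the Bernstein approximation in time, with values in the continuous functions on the torus. -/
theorem exists_time_interpolation {T : ℝ} (hT : 0 < T) {f : ℝ × Torus p → F}
    (hf : ContinuousOn f (Icc 0 T ×ˢ univ)) {ε : ℝ} (hε : 0 < ε) :
    ∃ (n : ℕ) (b : Fin n → ℝ → ℝ) (τ : Fin n → ℝ), (∀ k, ContDiff ℝ ∞ (b k)) ∧
      (∀ k, τ k ∈ Icc 0 T) ∧
      ∀ t ∈ Icc 0 T, ∀ x, ‖∑ k, b k t • f (τ k, x) - f (t, x)‖ ≤ ε := by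
  have hmem : ∀ s : unitInterval, T * (s : ℝ) ∈ Icc 0 T := fun s =>
    ⟨mul_nonneg hT.le s.2.1, mul_le_of_le_one_right hT.le s.2.2⟩
  let G : C(unitInterval × Torus p, F) := ⟨fun z => f (T * (z.1 : ℝ), z.2),
    hf.comp_continuous (by fun_prop) fun z => ⟨hmem z.1, mem_univ _⟩⟩
  have hlim := bernsteinApproximation_uniform (E := C(Torus p, F)) G.curry
  obtain ⟨n, hn⟩ := (Metric.tendsto_nhds.1 hlim ε hε).exists
  refine ⟨n + 1, fun k t => (n.choose k : ℝ) * (t / T) ^ (k : ℕ) * (1 - t / T) ^ (n - (k : ℕ)),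
    fun k => T * (bernstein.z k : unitInterval), fun k => by fun_prop, fun k => hmem _, ?_⟩
  intro t ht x
  have htI : t / T ∈ unitInterval := ⟨div_nonneg ht.1 hT.le, div_le_one_of_le₀ ht.2 hT.le⟩
  have h1 := (ContinuousMap.dist_lt_iff hε).1 hn ⟨t / T, htI⟩
  have h2 := (ContinuousMap.dist_lt_iff hε).1 h1 x
  rw [bernsteinApproximation.apply, dist_eq_norm] at h2
  simp only [ContinuousMap.sum_apply, ContinuousMap.smul_apply, bernstein_apply] at h2
  have h3 : G.curry ⟨t / T, htI⟩ x = f (t, x) := by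
    simp [G, mul_div_cancel₀ t hT.ne']
  rw [h3] at h2
  exact h2.le

end

section

variable {p : ℕ}

/-! ### The weak form of the gradient system -/

theorem integrable_frob_of_memLp {T : ℝ} {B W : ℝ × Torus p → Mat p}
    (hB : ∀ i j, MemLp (fun z => B z i j) ∞ (spaceTime p T))
    (hW : ∀ i j, Integrable (fun z => W z i j) (spaceTime p T)) :
    Integrable (fun z => frob (B z) (W z)) (spaceTime p T) := by
  refine integrable_finsetSum _ fun i _ => integrable_finsetSum _ fun j _ => ?_
  exact (hW i j).mul_of_top_right (hB i j)

theorem integrable_inner_of_memLp_two {α : Type*} [MeasurableSpace α] {μ : Measure α}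
    {f g : α → Vec p} (hf : MemLp f 2 μ) (hg : MemLp g 2 μ) :
    Integrable (fun z => inner ℝ (f z) (g z)) μ :=
  (hf.norm.integrable_mul hg.norm).mono' (hf.1.inner hg.1)
    (Eventually.of_forall fun z => norm_inner_le_norm (f z) (g z))

theorem integrable_pairing {T : ℝ} {E : ℝ × Torus p → Vec p} {B : ℝ × Torus p → Mat p}
    {W : ℝ × Torus p → Mat p} {G : ℝ × Torus p → Vec p}
    (hE : MemLp E 2 (spaceTime p T)) (hB : ∀ i j, MemLp (fun z => B z i j) ∞ (spaceTime p T))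
    (hW : ∀ i j, Integrable (fun z => W z i j) (spaceTime p T)) (hG : MemLp G 2 (spaceTime p T)) :
    Integrable (fun z => frob (B z) (W z) + inner ℝ (E z) (G z)) (spaceTime p T) :=
  (integrable_frob_of_memLp hB hW).add (integrable_inner_of_memLp_two hE hG)

/-- The pairing `∫ (B, W) + (E, G)` is continuous for uniform convergence of `(W, G)`, so it
vanishes as soon as it vanishes at arbitrarily good approximations. -/
theorem pairing_eq_zero_of_approx {T : ℝ} {E : ℝ × Torus p → Vec p} {B : ℝ × Torus p → Mat p}
    (hE : MemLp E 2 (spaceTime p T)) (hB : ∀ i j, MemLp (fun z => B z i j) ∞ (spaceTime p T))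
    {W : ℝ × Torus p → Mat p} {G : ℝ × Torus p → Vec p}
    (hW : ∀ i j, Integrable (fun z => W z i j) (spaceTime p T)) (hG : MemLp G 2 (spaceTime p T))
    (h : ∀ ε > 0, ∃ (W' : ℝ × Torus p → Mat p) (G' : ℝ × Torus p → Vec p),
      (∀ i j, Integrable (fun z => W' z i j) (spaceTime p T)) ∧ MemLp G' 2 (spaceTime p T) ∧
      ∫ z, (frob (B z) (W' z) + inner ℝ (E z) (G' z)) ∂(spaceTime p T) = 0 ∧
      ∀ t ∈ Ioo 0 T, ∀ x, (∀ i j, |W (t, x) i j - W' (t, x) i j| ≤ ε) ∧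
        ‖G (t, x) - G' (t, x)‖ ≤ ε) :
    ∫ z, (frob (B z) (W z) + inner ℝ (E z) (G z)) ∂(spaceTime p T) = 0 := by
  set N : ℝ × Torus p → ℝ := fun z => (∑ i, ∑ j, |B z i j|) + ‖E z‖ with hN
  have hNi : Integrable N (spaceTime p T) := by
    refine Integrable.add ?_ (hE.integrable (by norm_num)).norm
    exact integrable_finsetSum _ fun i _ => integrable_finsetSum _ fun j _ =>
      ((hB i j).integrable le_top).abs
  have hbound : ∀ ε > 0, |∫ z, (frob (B z) (W z) + inner ℝ (E z) (G z)) ∂(spaceTime p T)|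
      ≤ (∫ z, N z ∂(spaceTime p T)) * ε := by
    intro ε hε
    obtain ⟨W', G', hW', hG', h0, hcl⟩ := h ε hε
    rw [← sub_zero (∫ z, (frob (B z) (W z) + inner ℝ (E z) (G z)) ∂(spaceTime p T)), ← h0,
      ← integral_sub (integrable_pairing hE hB hW hG) (integrable_pairing hE hB hW' hG'),
      ← integral_mul_const, ← Real.norm_eq_abs]
    refine norm_integral_le_of_norm_le (hNi.mul_const ε) ?_
    filter_upwards [ae_spaceTime_mem p T] with z hz
    obtain ⟨h1, h2⟩ := hcl z.1 hz z.2
    have e1 : frob (B z) (W z) + inner ℝ (E z) (G z) - (frob (B z) (W' z) + inner ℝ (E z) (G' z))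
        = (∑ i, ∑ j, B z i j * (W z i j - W' z i j)) + inner ℝ (E z) (G z - G' z) := by
      simp only [frob, mul_sub, Finset.sum_sub_distrib, inner_sub_right]; ring
    rw [e1, hN, add_mul, Finset.sum_mul]
    refine (norm_add_le _ _).trans (add_le_add ?_ ?_)
    · refine (norm_sum_le _ _).trans (Finset.sum_le_sum fun i _ => ?_)
      rw [Finset.sum_mul]
      refine (norm_sum_le _ _).trans (Finset.sum_le_sum fun j _ => ?_)
      rw [norm_mul, Real.norm_eq_abs]
      exact mul_le_mul_of_nonneg_left (h1 i j) (abs_nonneg _)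
    · exact (norm_inner_le_norm _ _).trans (mul_le_mul_of_nonneg_left h2 (norm_nonneg _))
  have hN0 : 0 ≤ ∫ z, N z ∂(spaceTime p T) := integral_nonneg fun z => by positivity
  rw [← abs_nonpos_iff]
  refine le_of_forall_pos_le_add fun η hη => ?_
  refine (hbound (η / ((∫ z, N z ∂(spaceTime p T)) + 1)) (by positivity)).trans ?_
  rw [zero_add, mul_div_assoc', div_le_iff₀ (by positivity)]
  nlinarith

theorem hasDerivAt_primitive {b : ℝ → ℝ} (hb : Continuous b) (t : ℝ) :
    HasDerivAt (fun s => ∫ r in 0..s, b r) (b t) t :=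
  intervalIntegral.integral_hasDerivAt_right (hb.intervalIntegrable 0 t)
    hb.stronglyMeasurable.stronglyMeasurableAtFilter hb.continuousAt

theorem contDiff_primitive {b : ℝ → ℝ} (hb : ContDiff ℝ ∞ b) :
    ContDiff ℝ ∞ fun s => ∫ r in 0..s, b r := by
  rw [contDiff_infty_iff_deriv]
  refine ⟨fun t => (hasDerivAt_primitive hb.continuous t).differentiableAt, ?_⟩
  rwa [show deriv (fun s => ∫ r in 0..s, b r) = b from
    funext fun t => (hasDerivAt_primitive hb.continuous t).deriv]

/-- Finite sums of separated variables: primitives of functions of time multiplied by mollified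
matrix functions of space. -/
def separatedField (φ : ContDiffBump (0 : Vec p)) {n : ℕ} (b : Fin n → ℝ → ℝ)
    (a : Fin n → Torus p → Fin p → Fin p → ℝ) (z : ℝ × Torus p) : Mat p :=
  Matrix.of fun i j => ∑ k, (∫ r in 0..z.1, b k r) * moll φ (fun x => a k x i j) z.2

section SeparatedField

variable {φ : ContDiffBump (0 : Vec p)} {n : ℕ} {b : Fin n → ℝ → ℝ}
  {a : Fin n → Torus p → Fin p → Fin p → ℝ}

theorem isTestField_separatedField {T : ℝ} (hb : ∀ k, ContDiff ℝ ∞ (b k))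
    (ha : ∀ k i j, Continuous fun x => a k x i j) (hsymm : ∀ k x i j, a k x i j = a k x j i) :
    IsTestField T (separatedField φ b a) where
  smooth i j := by
    refine ContDiff.contDiffOn (f := fun z : ℝ × Vec p => ∑ k, (∫ r in 0..z.1, b k r) *
      moll φ (fun x => a k x i j) (Torus.mk z.2)) (ContDiff.sum fun k _ => ?_)
    have h1 : ContDiff ℝ ∞ fun z : ℝ × Vec p => ∫ r in 0..z.1, b k r :=
      (contDiff_primitive (hb k)).comp contDiff_fst
    have h2 : ContDiff ℝ ∞ fun z : ℝ × Vec p => moll φ (fun x => a k x i j) (Torus.mk z.2) :=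
      (contDiff_moll φ (ha k i j)).comp contDiff_snd
    exact h1.mul h2
  symm z := by
    ext i j
    simp only [Matrix.transpose_apply, separatedField, Matrix.of_apply]
    exact Finset.sum_congr rfl fun k _ => by simp only [hsymm k _ i j]
  initial x := by
    ext i j
    simp [separatedField]

theorem timeDeriv_separatedField_eq_sum (hb : ∀ k, Continuous (b k)) (t : ℝ) (x : Torus p)
    (i j : Fin p) : timeDeriv (separatedField φ b a) (t, x) i j =
      ∑ k, b k t * moll φ (fun x => a k x i j) x := by
  simp only [timeDeriv, Matrix.of_apply, separatedField]
  exact (HasDerivAt.fun_sum (u := Finset.univ) fun k _ =>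
    (hasDerivAt_primitive (hb k) t).mul_const (moll φ (fun x => a k x i j) x)).deriv

theorem moll_sum_mul {ι : Type*} (φ : ContDiffBump (0 : Vec p)) (s : Finset ι) (c : ι → ℝ)
    {f : ι → Torus p → ℝ} (hf : ∀ i, Continuous (f i)) (x : Torus p) :
    moll φ (fun y => ∑ i ∈ s, c i * f i y) x = ∑ i ∈ s, c i * moll φ (f i) x := by
  rw [moll_sum φ _ fun i _ => (hf i).const_mul _]
  exact Finset.sum_congr rfl fun i _ => moll_const_smul φ (f i) (c i) x

theorem timeDeriv_separatedField (hb : ∀ k, Continuous (b k))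
    (ha : ∀ k i j, Continuous fun x => a k x i j) (t : ℝ) (x : Torus p)
    (i j : Fin p) : timeDeriv (separatedField φ b a) (t, x) i j =
      moll φ (fun x => ∑ k, b k t * a k x i j) x := by
  rw [timeDeriv_separatedField_eq_sum hb, moll_sum_mul φ _ _ fun k => ha k i j]

theorem opL_separatedField (ha : ∀ k i j, Continuous fun x => a k x i j) (t : ℝ) (x : Torus p) :
    opL (fun x => separatedField φ b a (t, x)) x = torusGrad (moll φ fun x =>
      ∑ k, (-(1 / 2) * ∫ r in 0..t, b k r) * ∑ i, a k x i i) x := by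
  have htr : ∀ k, Continuous fun x => ∑ i, a k x i i := fun k =>
    continuous_finsetSum _ fun i _ => ha k i i
  set A : Torus p → ℝ := fun x => ∑ k, (-(1 / 2) * ∫ r in 0..t, b k r) * ∑ i, a k x i i with hA
  have hAc : Continuous A := continuous_finsetSum _ fun k _ => continuous_const.mul (htr k)
  have h1 : (fun y => opU (separatedField φ b a (t, y))) = fun y => -moll φ A y := by
    funext y
    have h2 : ∀ k, moll φ (fun x => ∑ i, a k x i i) y = ∑ i, moll φ (fun x => a k x i i) y :=
      fun k => moll_sum φ _ (fun i _ => ha k i i) y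
    rw [hA, moll_sum_mul φ _ _ htr]
    simp only [h2, opU, separatedField, Matrix.trace, Matrix.diag_apply, Matrix.of_apply]
    rw [Finset.sum_comm, Finset.mul_sum, ← Finset.sum_neg_distrib]
    refine Finset.sum_congr rfl fun k _ => ?_
    rw [← Finset.mul_sum]; ring
  rw [opL, h1]
  obtain ⟨y, rfl⟩ := Torus.surjective_mk x
  have h3 : DifferentiableAt ℝ (fun w => moll φ A (Torus.mk w)) y :=
    (contDiff_moll φ hAc).differentiable (by simp) y
  have h4 : HasGradientAt (fun w => -moll φ A (Torus.mk w))
      (-∇ (fun w => moll φ A (Torus.mk w)) y) y := by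
    rw [hasGradientAt_iff_hasFDerivAt, map_neg]
    exact h3.hasGradientAt.hasFDerivAt.neg
  rw [torusGrad_eq_gradient h3, torusGrad_of_hasGradientAt (f := fun y => -moll φ A y) h4, neg_neg]

theorem continuous_timeDeriv_separatedField (hb : ∀ k, Continuous (b k))
    (ha : ∀ k i j, Continuous fun x => a k x i j) (i j : Fin p) :
    Continuous fun z => timeDeriv (separatedField φ b a) z i j := by
  have h : (fun z : ℝ × Torus p => timeDeriv (separatedField φ b a) z i j) = fun z =>
      ∑ k, b k z.1 * moll φ (fun x => a k x i j) z.2 :=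
    funext fun z => timeDeriv_separatedField_eq_sum hb z.1 z.2 i j
  rw [h]
  refine continuous_finsetSum _ fun k _ => ?_
  exact ((hb k).comp continuous_fst).mul ((continuous_moll φ (ha k i j)).comp continuous_snd)

end SeparatedField

theorem SmoothMatField.opU {T : ℝ} {Ψ : ℝ × Torus p → Mat p} (h : SmoothMatField T Ψ) :
    SmoothField T fun z => opU (Ψ z) := by
  have : (fun z : ℝ × Vec p => HJDual.opU (Ψ (z.1, Torus.mk z.2))) =
      fun z => (1 / 2) * ∑ i, Ψ (z.1, Torus.mk z.2) i i := by
    funext z; simp [HJDual.opU, Matrix.trace]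
  rw [SmoothField, this]
  exact contDiffOn_const.mul (ContDiffOn.sum fun i _ => h i i)

theorem IsTestField.continuousOn_opL {T : ℝ} (hT : 0 < T) {Ψ : ℝ × Torus p → Mat p}
    (h : IsTestField T Ψ) :
    ContinuousOn (fun z : ℝ × Torus p => opL (fun x => Ψ (z.1, x)) z.2) (Icc 0 T ×ˢ univ) := by
  obtain ⟨_, _, h2, _⟩ := h.smooth.opU.exists_timeDeriv hT
  exact h2.neg

theorem continuousOn_apply_mul_apply {s : Set (ℝ × Torus p)} {v : ℝ × Torus p → Vec p}
    (hv : ContinuousOn v s) (i j : Fin p) : ContinuousOn (fun z => v z i * v z j) s := by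
  have h1 : ∀ i, ContinuousOn (fun z => v z i) s := fun i =>
    (continuous_apply i).comp_continuousOn ((PiLp.continuous_ofLp 2 _).comp_continuousOn hv)
  exact (h1 i).mul (h1 j)

/-- If `∑ₖ bₖ aₖ` is close to `v ⊗ v`, then the trace part of its primitive is close to
`-½ ∫₀ᵗ |v|²`. -/
theorem abs_primitive_trace_sub_le {T η : ℝ} {v : ℝ × Torus p → Vec p}
    (hv : ContinuousOn v (Icc 0 T ×ˢ univ)) (hη : 0 ≤ η) {n : ℕ} {b : Fin n → ℝ → ℝ}
    (hb : ∀ k, Continuous (b k)) {a : Fin n → Fin p → Fin p → ℝ} {t : ℝ} (ht : t ∈ Icc 0 T)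
    (x : Torus p)
    (h : ∀ s ∈ Icc 0 T, ∀ i, |v (s, x) i * v (s, x) i - ∑ k, b k s * a k i i| ≤ η) :
    |(∑ k, (-(1 / 2) * ∫ r in 0..t, b k r) * ∑ i, a k i i)
      - -(1 / 2) * ∫ s in 0..t, ‖v (s, x)‖ ^ 2| ≤ T * p * η := by
  have hvx : ContinuousOn (fun s => ‖v (s, x)‖ ^ 2) (Icc 0 T) :=
    (hv.comp (by fun_prop) fun s hs => ⟨hs, mem_univ _⟩ : ContinuousOn
      (fun s => v (s, x)) (Icc 0 T)).norm.pow 2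
  have hbc : ∀ k, Continuous fun s => b k s * ∑ i, a k i i := fun k =>
    (hb k).mul continuous_const
  have h1 : (∑ k, (-(1 / 2) * ∫ r in 0..t, b k r) * ∑ i, a k i i)
      - -(1 / 2) * ∫ s in 0..t, ‖v (s, x)‖ ^ 2 = -(1 / 2) * ∫ s in 0..t,
        ((∑ k, b k s * ∑ i, a k i i) - ‖v (s, x)‖ ^ 2) := by
    rw [intervalIntegral.integral_sub
      ((continuous_finsetSum _ fun k _ => hbc k).intervalIntegrable _ _)
      ((hvx.mono (Icc_subset_Icc_right ht.2)).intervalIntegrable_of_Icc ht.1),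
      intervalIntegral.integral_finsetSum fun k _ => (hbc k).intervalIntegrable _ _, mul_sub,
      Finset.mul_sum]
    simp only [intervalIntegral.integral_mul_const, mul_assoc]
  have h2 : ∀ s ∈ uIoc 0 t, ‖(∑ k, b k s * ∑ i, a k i i) - ‖v (s, x)‖ ^ 2‖ ≤ p * η := by
    intro s hs
    rw [uIoc_of_le ht.1] at hs
    have hs' : s ∈ Icc 0 T := ⟨hs.1.le, hs.2.trans ht.2⟩
    have h3 : (∑ k, b k s * ∑ i, a k i i) - ‖v (s, x)‖ ^ 2 =
        ∑ i, -(v (s, x) i * v (s, x) i - ∑ k, b k s * a k i i) := by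
      simp only [neg_sub, Finset.sum_sub_distrib, EuclideanSpace.real_norm_sq_eq, Finset.mul_sum]
      rw [Finset.sum_comm]
      simp only [pow_two]
    rw [h3]
    refine (norm_sum_le _ _).trans ((Finset.sum_le_sum fun i _ =>
      (norm_neg _).trans_le (h s hs' i)).trans ?_)
    simp
  have h3 := intervalIntegral.norm_integral_le_of_norm_le_const h2
  rw [h1, abs_mul]
  rw [Real.norm_eq_abs, sub_zero, abs_of_nonneg ht.1] at h3
  have h4 : |(-(1 / 2) : ℝ)| = 1 / 2 := by norm_num
  have h5 : (p : ℝ) * η * t ≤ p * η * T := mul_le_mul_of_nonneg_left ht.2 (by positivity)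
  have h6 := abs_nonneg (∫ s in 0..t, ((∑ k, b k s * ∑ i, a k i i) - ‖v (s, x)‖ ^ 2))
  rw [h4]
  linarith

/-- The weak form of the Hamilton-Jacobi equation against mollified fields: the pair
`(v ⊗ v, v - v₀) = (∂ₜΨ, LΨ)` with `Ψ(t) = ∫₀ᵗ v ⊗ v` becomes an honest smooth test field after
mollification in space and interpolation in time. -/
theorem Admissible.pairing_moll_eq_zero {T : ℝ} (hT : 0 < T) {E : ℝ × Torus p → Vec p}
    {B : ℝ × Torus p → Mat p} (hadm : Admissible T E B) {ψs : Torus p → ℝ} {ψ : ℝ × Torus p → ℝ}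
    {v₀ : Torus p → Vec p} {v : ℝ × Torus p → Vec p} (hψc : ContinuousOn ψ (Icc 0 T ×ˢ univ))
    (hψs : Continuous ψs) (hv : ContinuousOn v (Icc 0 T ×ˢ univ)) (hv₀ : Continuous v₀)
    (hgrad₀ : IsTorusGradient ψs v₀)
    (hgrad : ∀ t ∈ Icc 0 T, IsTorusGradient (fun x => ψ (t, x)) (fun x => v (t, x)))
    (hHJ : ∀ t ∈ Icc 0 T, ∀ x, ψ (t, x) = ψs x - (1 / 2) * ∫ s in 0..t, ‖v (s, x)‖ ^ 2)
    (φ : ContDiffBump (0 : Vec p))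
    (hWi : ∀ i j, Integrable (fun z : ℝ × Torus p =>
      moll φ (fun x => v (z.1, x) i * v (z.1, x) j) z.2) (spaceTime p T))
    (hGi : MemLp (fun z : ℝ × Torus p => moll φ (fun x => v (z.1, x) - v₀ x) z.2) 2
      (spaceTime p T)) :
    ∫ z, (frob (B z) (Matrix.of fun i j => moll φ (fun x => v (z.1, x) i * v (z.1, x) j) z.2)
      + inner ℝ (E z) (moll φ (fun x => v (z.1, x) - v₀ x) z.2)) ∂(spaceTime p T) = 0 := by
  set A : ℝ × Torus p → Fin p → Fin p → ℝ := fun z i j => v z i * v z j with hA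
  have hAc : ContinuousOn A (Icc 0 T ×ˢ univ) :=
    continuousOn_pi.2 fun i => continuousOn_pi.2 fun j => continuousOn_apply_mul_apply hv i j
  have hslice : ∀ t ∈ Icc 0 T, ∀ i j, Continuous fun x => A (t, x) i j := fun t ht i j =>
    continuous_slice (continuousOn_apply_mul_apply hv i j) ht
  obtain ⟨C, hC0, hC⟩ := exists_norm_torusGrad_moll_le φ
  refine pairing_eq_zero_of_approx hadm.memLp_E hadm.memLp_B hWi hGi fun ε hε => ?_
  -- the bump is fixed, so the constant `C` bounding the gradients is available in choosing `η`
  set η := min ε (ε / (C * (T * p) + 1)) with hη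
  have hη0 : 0 < η := lt_min hε (by positivity)
  have hηC : C * (T * p * η) ≤ ε := by
    have : η * (C * (T * p) + 1) ≤ ε := by
      rw [← le_div_iff₀ (by positivity)]; exact min_le_right _ _
    linarith
  obtain ⟨n, b, τ, hb, hτ, hclose⟩ := exists_time_interpolation hT hAc hη0
  have hbc : ∀ k, Continuous (b k) := fun k => (hb k).continuous
  have hAτ : ∀ k i j, Continuous fun x => A (τ k, x) i j := fun k => hslice _ (hτ k)
  have hentry : ∀ t ∈ Icc 0 T, ∀ x i j, |A (t, x) i j - ∑ k, b k t * A (τ k, x) i j| ≤ η := by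
    intro t ht x i j
    have h1 := (norm_le_pi_norm _ j).trans ((norm_le_pi_norm _ i).trans (hclose t ht x))
    rw [abs_sub_comm]
    simpa [Finset.sum_apply] using h1
  set Ψ := separatedField φ b fun k x => A (τ k, x) with hΨ
  have hΨt : IsTestField T Ψ :=
    isTestField_separatedField hb hAτ fun k x i j => mul_comm _ _
  -- `a t` approximates `-½ ∫₀ᵗ |v|² = ψ(t,·) - ψ⋆`, whose gradient is `v - v₀`
  set a : ℝ → Torus p → ℝ := fun t x =>
    ∑ k, (-(1 / 2) * ∫ r in 0..t, b k r) * ∑ i, A (τ k, x) i i with ha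
  have hac : ∀ t, Continuous (a t) := fun t => continuous_finsetSum _ fun k _ =>
    continuous_const.mul (continuous_finsetSum _ fun i _ => hAτ k i i)
  refine ⟨timeDeriv Ψ, fun z => opL (fun x => Ψ (z.1, x)) z.2,
    fun i j => integrable_of_continuousOn_slab
      (continuous_timeDeriv_separatedField hbc hAτ i j).continuousOn,
    memLp_of_continuousOn_slab (hΨt.continuousOn_opL hT) 2,
    hadm.constraint Ψ hΨt, fun t ht x => ⟨fun i j => ?_, ?_⟩⟩
  · have ht' := Ioo_subset_Icc_self ht
    have hc2 : Continuous fun x => ∑ k, b k t * A (τ k, x) i j :=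
      continuous_finsetSum _ fun k _ => (hAτ k i j).const_mul _
    rw [hΨ, timeDeriv_separatedField hbc hAτ, Matrix.of_apply]
    refine le_trans ?_ (min_le_left _ _ : η ≤ ε)
    have h1 := moll_sub φ (hslice t ht' i j) hc2 x
    have h2 := norm_moll_le φ (f := fun x => A (t, x) i j - ∑ k, b k t * A (τ k, x) i j)
      (fun x => hentry t ht' x i j) x
    rw [h1] at h2
    exact h2
  · have ht' := Ioo_subset_Icc_self ht
    have hD : IsTorusGradient (fun x => ψ (t, x) - ψs x) (fun x => v (t, x) - v₀ x) := by
      intro y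
      rw [hasGradientAt_iff_hasFDerivAt, map_sub]
      exact (hgrad t ht' y).hasFDerivAt.sub (hgrad₀ y).hasFDerivAt
    have hDc : Continuous fun x => ψ (t, x) - ψs x := (continuous_slice hψc ht').sub hψs
    have hm := hD.moll φ ((continuous_slice hv ht').sub hv₀)
    obtain ⟨y, rfl⟩ := Torus.surjective_mk x
    have h3 : DifferentiableAt ℝ (fun w => moll φ (a t) (Torus.mk w)) y :=
      (contDiff_moll φ (hac t)).differentiable (by simp) y
    have h4 : torusGrad (moll φ fun x => (ψ (t, x) - ψs x) - a t x) (Torus.mk y)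
        = moll φ (fun x => v (t, x) - v₀ x) (Torus.mk y)
          - torusGrad (moll φ (a t)) (Torus.mk y) := by
      refine torusGrad_of_hasGradientAt ?_
      have e : (fun w => moll φ (fun x => (ψ (t, x) - ψs x) - a t x) (Torus.mk w)) =
          fun w => moll φ (fun x => ψ (t, x) - ψs x) (Torus.mk w) - moll φ (a t) (Torus.mk w) := by
        funext w; exact moll_sub φ hDc (hac t) _
      rw [e, torusGrad_eq_gradient h3, hasGradientAt_iff_hasFDerivAt, map_sub]
      exact (hm y).hasFDerivAt.sub h3.hasGradientAt.hasFDerivAt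
    have h5 : opL (fun x => Ψ (t, x)) (Torus.mk y) = torusGrad (moll φ (a t)) (Torus.mk y) :=
      opL_separatedField hAτ t _
    simp only [h5]
    rw [← h4]
    refine (hC _ (hDc.sub (hac t)) (T * p * η) (fun x => ?_) _).trans hηC
    have h6 := abs_primitive_trace_sub_le hv hη0.le hbc ht' x fun s hs i => hentry s hs x i i
    have h7 : ψ (t, x) - ψs x = -(1 / 2) * ∫ s in 0..t, ‖v (s, x)‖ ^ 2 := by
      rw [hHJ t ht' x]; ring
    rw [← h7, abs_sub_comm] at h6
    exact h6

/-- The continuous gradient of a viscosity solution is a weak solution: the linear part of the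
saddle functional vanishes at `v`, for every admissible pair. -/
theorem Admissible.pairing_eq_zero {T : ℝ} (hT : 0 < T) {E : ℝ × Torus p → Vec p}
    {B : ℝ × Torus p → Mat p} (hadm : Admissible T E B) {ψs : Torus p → ℝ} {ψ : ℝ × Torus p → ℝ}
    {v₀ : Torus p → Vec p} {v : ℝ × Torus p → Vec p} (hψ : IsViscositySolution T ψs ψ)
    (hv : ContinuousOn v (Icc 0 T ×ˢ univ)) (hv₀ : Continuous v₀)
    (hgrad₀ : IsTorusGradient ψs v₀)
    (hgrad : ∀ t ∈ Icc 0 T, IsTorusGradient (fun x => ψ (t, x)) (fun x => v (t, x))) :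
    ∫ z, (frob (B z) (tsq (v z)) + inner ℝ (E z) (v z - v₀ z.2)) ∂(spaceTime p T) = 0 := by
  have hentry : ∀ i j, ContinuousOn (fun z => v z i * v z j) (Icc 0 T ×ˢ univ) :=
    continuousOn_apply_mul_apply hv
  have hG : ContinuousOn (fun z : ℝ × Torus p => v z - v₀ z.2) (Icc 0 T ×ˢ univ) :=
    hv.sub (hv₀.comp continuous_snd).continuousOn
  have hA : ContinuousOn (fun z : ℝ × Torus p => fun i j => v z i * v z j) (Icc 0 T ×ˢ univ) :=
    continuousOn_pi.2 fun i => continuousOn_pi.2 fun j => hentry i j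
  have hψs : Continuous ψs := by
    have := continuous_slice hψ.continuousOn (left_mem_Icc.2 hT.le)
    simpa only [hψ.initial] using this
  refine pairing_eq_zero_of_approx hadm.memLp_E hadm.memLp_B
    (fun i j => integrable_of_continuousOn_slab (hentry i j)) (memLp_of_continuousOn_slab hG 2)
    fun ε hε => ?_
  obtain ⟨r₁, hr₁, h₁⟩ := exists_unif_slab hA hε
  obtain ⟨r₂, hr₂, h₂⟩ := exists_unif_slab hG hε
  have hr : 0 < min r₁ r₂ := lt_min hr₁ hr₂
  let φ : ContDiffBump (0 : Vec p) := ⟨min r₁ r₂ / 2, min r₁ r₂, half_pos hr, half_lt_self hr⟩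
  have hWc : ∀ i j, ContinuousOn (fun z : ℝ × Torus p =>
      moll φ (fun x => v (z.1, x) i * v (z.1, x) j) z.2) (Icc 0 T ×ˢ univ) := fun i j =>
    continuousOn_moll φ (hentry i j)
  have hGc : ContinuousOn (fun z : ℝ × Torus p => moll φ (fun x => v (z.1, x) - v₀ x) z.2)
      (Icc 0 T ×ˢ univ) := continuousOn_moll φ hG
  refine ⟨_, _, fun i j => integrable_of_continuousOn_slab (hWc i j),
    memLp_of_continuousOn_slab hGc 2, hadm.pairing_moll_eq_zero hT hψ.continuousOn hψs hv hv₀ hgrad₀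
      hgrad (fun t ht x => hψ.integral_eq hT hv hgrad ht x) φ
      (fun i j => integrable_of_continuousOn_slab (hWc i j)) (memLp_of_continuousOn_slab hGc 2),
    fun t ht x => ⟨fun i j => ?_, ?_⟩⟩
  · have ht' := Ioo_subset_Icc_self ht
    rw [abs_sub_comm]
    refine dist_moll_le φ (continuous_slice (hentry i j) ht') fun s hs => ?_
    have h3 := h₁ t ht' x (-s) (by rw [norm_neg]; exact hs.trans_le (min_le_left _ _))
    rw [Torus.mk_neg, ← sub_eq_add_neg] at h3
    exact (norm_le_pi_norm _ j).trans ((norm_le_pi_norm _ i).trans h3)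
  · have ht' := Ioo_subset_Icc_self ht
    rw [norm_sub_rev]
    refine dist_moll_le φ (continuous_slice hG ht') fun s hs => ?_
    have h3 := h₂ t ht' x (-s) (by rw [norm_neg]; exact hs.trans_le (min_le_right _ _))
    rwa [Torus.mk_neg, ← sub_eq_add_neg] at h3

end

section

variable {p : ℕ}

/-! ### Smooth approximate characteristics -/

/-- A continuous field on the slab is uniformly approximated by fields smooth in all variables. -/
theorem exists_smooth_approx {T : ℝ} (hT : 0 < T) {v : ℝ × Torus p → Vec p}
    (hv : ContinuousOn v (Icc 0 T ×ˢ univ)) {ε : ℝ} (hε : 0 < ε) :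
    ∃ w : ℝ × Torus p → Vec p, ContDiff ℝ ∞ (fun z : ℝ × Vec p => w (z.1, Torus.mk z.2)) ∧
      ∀ t ∈ Icc 0 T, ∀ x, ‖w (t, x) - v (t, x)‖ ≤ ε := by
  obtain ⟨r, hr, hunif⟩ := exists_unif_slab hv (half_pos hε)
  obtain ⟨n, b, τ, hb, hτ, hclose⟩ := exists_time_interpolation hT hv (half_pos hε)
  let φ : ContDiffBump (0 : Vec p) := ⟨r / 2, r, half_pos hr, half_lt_self hr⟩
  have hvτ : ∀ k, Continuous fun x => v (τ k, x) := fun k => continuous_slice hv (hτ k)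
  refine ⟨fun z => ∑ k, b k z.1 • moll φ (fun x => v (τ k, x)) z.2, ?_, fun t ht x => ?_⟩
  · refine ContDiff.sum fun k _ => ?_
    have h1 : ContDiff ℝ ∞ fun z : ℝ × Vec p => b k z.1 := (hb k).comp contDiff_fst
    have h2 : ContDiff ℝ ∞ fun z : ℝ × Vec p => moll φ (fun x => v (τ k, x)) (Torus.mk z.2) :=
      (contDiff_moll φ (hvτ k)).comp contDiff_snd
    exact h1.smul h2
  · have h1 : ∑ k, b k t • moll φ (fun x => v (τ k, x)) x
        = moll φ (fun x => ∑ k, b k t • v (τ k, x)) x := by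
      rw [moll_sum φ _ (f := fun k x => b k t • v (τ k, x))
        fun k _ => (hvτ k).fun_const_smul (b k t)]
      exact Finset.sum_congr rfl fun k _ => (moll_const_smul φ _ _ _).symm
    have hc : Continuous fun x => ∑ k, b k t • v (τ k, x) :=
      continuous_finsetSum _ fun k _ => (hvτ k).fun_const_smul _
    have h2 := norm_moll_le φ (f := fun x => ∑ k, b k t • v (τ k, x) - v (t, x))
      (fun x => hclose t ht x) x
    rw [moll_sub φ hc (continuous_slice hv ht)] at h2
    have h3 : ‖moll φ (fun x => v (t, x)) x - v (t, x)‖ ≤ ε / 2 := by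
      refine dist_moll_le φ (continuous_slice hv ht) fun s hs => ?_
      have := hunif t ht x (-s) (by rw [norm_neg]; exact hs)
      rwa [Torus.mk_neg, ← sub_eq_add_neg] at this
    simp only [h1]
    have := norm_add_le_of_le h2 h3
    rwa [sub_add_sub_cancel, add_halves] at this

/-- Integral curves of a smooth field that end at a prescribed point at time `T`. -/
theorem exists_smooth_curve {T : ℝ} (hT : 0 < T) {w : ℝ × Torus p → Vec p}
    (hw : ContDiff ℝ ∞ (fun z : ℝ × Vec p => w (z.1, Torus.mk z.2))) (a : Vec p) :
    ∃ X : ℝ → Vec p, ContDiffOn ℝ ∞ X (Icc 0 T) ∧ X T = a ∧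
      ∀ t ∈ Icc 0 T, HasDerivWithinAt X (w (t, Torus.mk (X t))) (Icc 0 T) t := by
  set W : ℝ × Vec p → Vec p := fun z => w (z.1, Torus.mk z.2) with hW
  obtain ⟨L, hL0, hL⟩ := exists_norm_bound_slab (f := w) (T := T)
    (continuousOn_slab_iff_lift.2 hw.continuous.continuousOn)
  have hTI : T ∈ Icc 0 T := right_mem_Icc.2 hT.le
  -- solutions cannot leave the ball of radius `L T`, on which the field is Lipschitz in space
  obtain ⟨C, hC⟩ :=
    (isCompact_Icc.prod (isCompact_closedBall a (L * T))).exists_bound_of_continuousOn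
    (s := Icc 0 T ×ˢ Metric.closedBall a (L * T)) (hw.continuous_fderiv (by simp)).continuousOn
  have hlip : ∀ t ∈ Icc 0 T, LipschitzOnWith (Real.toNNReal C) (fun y => w (t, Torus.mk y))
      (Metric.closedBall a (L * T)) := by
    intro t ht
    refine (convex_closedBall a (L * T)).lipschitzOnWith_of_nnnorm_hasFDerivWithin_le
      (f' := fun y => (fderiv ℝ W (t, y)).comp (ContinuousLinearMap.inr ℝ ℝ (Vec p)))
      (fun y hy => ?_) fun y hy => ?_
    · have h1 : HasFDerivAt W (fderiv ℝ W (t, y)) (t, y) :=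
        (hw.differentiable (by simp) _).hasFDerivAt
      exact (h1.comp (f := fun w : Vec p => (t, w)) y
        (hasFDerivAt_prodMk_right t y)).hasFDerivWithinAt
    · rw [← NNReal.coe_le_coe, coe_nnnorm]
      refine le_trans ?_ (Real.le_coe_toNNReal C)
      refine (ContinuousLinearMap.opNorm_comp_le _ _).trans ?_
      have h2 : ‖ContinuousLinearMap.inr ℝ ℝ (Vec p)‖ ≤ 1 :=
        ContinuousLinearMap.opNorm_le_bound _ zero_le_one fun e => by simp [Prod.norm_def]
      exact (mul_le_of_le_one_right (norm_nonneg _) h2).trans (hC (t, y) ⟨ht, hy⟩)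
  have hPL : IsPicardLindelof (fun t y => w (t, Torus.mk y)) (⟨T, hTI⟩ : Icc 0 T) a
      (Real.toNNReal (L * T)) 0 (Real.toNNReal L) (Real.toNNReal C) := by
    have hLT : ((Real.toNNReal (L * T) : NNReal) : ℝ) = L * T :=
      Real.coe_toNNReal _ (mul_nonneg hL0 hT.le)
    refine ⟨fun t ht => ?_, fun y _ => ?_, fun t ht y _ => ?_, ?_⟩
    · rw [hLT]; exact hlip t ht
    · exact (hw.continuous.comp (Continuous.prodMk_left y)).continuousOn
    · rw [Real.coe_toNNReal _ hL0]; exact hL t ht _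
    · rw [hLT, Real.coe_toNNReal _ hL0]
      simp [hT.le]
  obtain ⟨X, hX, hX'⟩ := hPL.exists_eq_forall_mem_Icc_hasDerivWithinAt₀
  refine ⟨X, ?_, hX, hX'⟩
  exact ODE.contDiffOn_enat_Icc_of_hasDerivWithinAt (n := ⊤) (u := univ)
    (f := fun t y => w (t, Torus.mk y)) hw.contDiffOn hX' (mapsTo_univ _ _)

/-! ### A smooth kernel on the torus -/

/-- A bump function on the circle, positive exactly where `cos 2πs > c`. -/
def circleBump (c : ℝ) (s : UnitAddCircle) : ℝ :=
  expNegInvGlue ((AddCircle.toCircle s : ℂ).re - c)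

theorem circleBump_coe (c x : ℝ) :
    circleBump c (x : UnitAddCircle) = expNegInvGlue (Real.cos (2 * Real.pi * x) - c) := by
  have h := Complex.exp_ofReal_mul_I_re (2 * Real.pi * x)
  rw [circleBump, AddCircle.toCircle_apply_mk, Circle.coe_exp, div_one, h]

theorem contDiff_circleBump_sub (c : ℝ) (a : UnitAddCircle) :
    ContDiff ℝ ∞ fun x : ℝ => circleBump c ((x : UnitAddCircle) - a) := by
  induction a using QuotientAddGroup.induction_on with
  | H a =>
    have : (fun x : ℝ => circleBump c ((x : UnitAddCircle) - (a : UnitAddCircle))) =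
        fun x => expNegInvGlue (Real.cos (2 * Real.pi * (x - a)) - c) := by
      funext x
      rw [← circleBump_coe, AddCircle.coe_sub]
    exact this ▸ expNegInvGlue.contDiff.comp (by fun_prop)

/-- A smooth nonnegative kernel concentrated near the origin of the circle whose translates along a
finite subgroup form a partition of unity: a bump divided by the sum of its translates. -/
theorem exists_circle_kernel {r : ℝ} (hr : 0 < r) :
    ∃ (N : ℕ) (_ : NeZero N) (k : UnitAddCircle → ℝ),
      ContDiff ℝ ∞ (fun x : ℝ => k (x : UnitAddCircle)) ∧ (∀ s, 0 ≤ k s) ∧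
      (∀ s, ∑ j : ZMod N, k (s - ZMod.toAddCircle j) = 1) ∧
      ∀ s, k s ≠ 0 → ∃ x : ℝ, |x| < r ∧ (x : UnitAddCircle) = s := by
  set ρ := min r (1 / 4) with hρ
  have hρ0 : 0 < ρ := lt_min hr (by norm_num)
  have hρ4 : ρ ≤ 1 / 4 := min_le_right _ _
  have hpi := Real.pi_pos
  set c := Real.cos (2 * Real.pi * ρ) with hc
  obtain ⟨N, hN⟩ := exists_nat_gt (1 / ρ)
  have hN0 : (0 : ℝ) < N := lt_trans (by positivity) hN
  have : NeZero N := ⟨by rintro rfl; simp at hN0⟩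
  have hNρ : 1 / (2 * N) < ρ := by
    rw [div_lt_iff₀ hρ0] at hN
    rw [div_lt_iff₀ (by positivity)]; linarith
  set Z : UnitAddCircle → ℝ := fun s => ∑ j : ZMod N, circleBump c (s - ZMod.toAddCircle j) with hZ
  have hnn : ∀ s, 0 ≤ circleBump c s := fun s => expNegInvGlue.nonneg _
  have hZpos : ∀ s, 0 < Z s := by
    intro s
    induction s using QuotientAddGroup.induction_on with
    | H x =>
      refine Finset.sum_pos' (fun j _ => hnn _)
        ⟨((round (N * x) : ℤ) : ZMod N), Finset.mem_univ _, ?_⟩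
      have h1 : |x - (round (N * x) : ℝ) / N| < ρ := by
        have h2 := abs_sub_round (N * x)
        have h3 : x - (round (N * x) : ℝ) / N = (N * x - round (N * x)) / N := by
          field_simp
        rw [h3, abs_div, abs_of_pos hN0]
        refine lt_of_le_of_lt ?_ hNρ
        rw [div_le_div_iff₀ hN0 (by positivity)]
        linarith [mul_le_mul_of_nonneg_right h2 hN0.le]
      rw [ZMod.toAddCircle_intCast]
      have h4 := circleBump_coe c (x - (round (N * x) : ℝ) / N)
      rw [AddCircle.coe_sub] at h4
      refine lt_of_lt_of_eq (expNegInvGlue.pos_of_pos ?_) h4.symm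
      rw [sub_pos, hc, ← Real.cos_abs (2 * Real.pi * (x - _)), abs_mul,
        abs_of_pos (by positivity : 0 < 2 * Real.pi)]
      exact Real.cos_lt_cos_of_nonneg_of_le_pi (by positivity) (by nlinarith) (by gcongr)
  have hZper : ∀ s (i : ZMod N), Z (s - ZMod.toAddCircle i) = Z s := by
    intro s i
    simp only [hZ, sub_sub, ← map_add]
    exact Equiv.sum_comp (Equiv.addLeft i) fun j => circleBump c (s - ZMod.toAddCircle j)
  refine ⟨N, this, fun s => circleBump c s / Z s, ?_, fun s => div_nonneg (hnn _) (hZpos _).le,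
    fun s => ?_, fun s hs => ?_⟩
  · have h1 := contDiff_circleBump_sub c 0
    simp only [sub_zero] at h1
    exact h1.div (ContDiff.sum fun j _ => contDiff_circleBump_sub c _) fun x => (hZpos _).ne'
  · simp only [hZper]
    rw [← Finset.sum_div]
    exact div_self (hZpos s).ne'
  · induction s using QuotientAddGroup.induction_on with
    | H x =>
      have h2 : ((x - round x : ℝ) : UnitAddCircle) = (x : UnitAddCircle) := by
        rw [AddCircle.coe_sub, sub_eq_self, AddCircle.coe_eq_zero_iff]
        exact ⟨round x, by simp⟩
      refine ⟨x - round x, ?_, h2⟩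
      have hs' : circleBump c ((x - round x : ℝ) : UnitAddCircle) ≠ 0 := by
        rw [h2]
        intro h; exact hs (by simp only [h, zero_div])
      rw [circleBump_coe] at hs'
      have h3 : 0 < Real.cos (2 * Real.pi * (x - round x)) - c := by
        by_contra! h; exact hs' (expNegInvGlue.zero_of_nonpos h)
      refine lt_of_lt_of_le ?_ (min_le_left _ _ : ρ ≤ r)
      by_contra! h4
      have h5 := abs_sub_round x
      have h6 : Real.cos (2 * Real.pi * |x - round x|) ≤ c :=
        Real.cos_le_cos_of_nonneg_of_le_pi (by positivity) (by nlinarith) (by gcongr)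
      rw [← Real.cos_abs, abs_mul, abs_of_pos (by positivity : 0 < 2 * Real.pi)] at h3
      linarith

theorem norm_le_of_forall_abs_le {x : Vec p} {ε : ℝ} (h : ∀ i, |x i| ≤ ε) :
    ‖x‖ ≤ p * ε := by
  have h1 : ‖x‖ ≤ ∑ i, |x i| := by
    have : x = ∑ i, x i • EuclideanSpace.single i (1 : ℝ) := by
      ext j; simp [Finset.sum_apply, Pi.single_apply]
    calc ‖x‖ = ‖∑ i, x i • EuclideanSpace.single i (1 : ℝ)‖ := by rw [← this]
      _ ≤ ∑ i, ‖x i • EuclideanSpace.single i (1 : ℝ)‖ := norm_sum_le _ _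
      _ = ∑ i, |x i| := by simp [norm_smul]
  refine h1.trans ((Finset.sum_le_sum fun i _ => h i).trans ?_)
  simp

/-- The product of circle kernels: a smooth kernel on the torus, concentrated near the origin, whose
translates along a finite grid form a partition of unity. -/
theorem exists_torus_kernel (p : ℕ) {r : ℝ} (hr : 0 < r) :
    ∃ (ι : Type) (_ : Fintype ι) (a : ι → Vec p) (K : Torus p → ℝ),
      ContDiff ℝ ∞ (fun y => K (Torus.mk y)) ∧ (∀ x, 0 ≤ K x) ∧
      (∀ x, ∑ i, K (x - Torus.mk (a i)) = 1) ∧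
      ∀ x, K x ≠ 0 → ∃ s : Vec p, ‖s‖ < r ∧ Torus.mk s = x := by
  obtain ⟨N, hN, k, hk, hk0, hk1, hks⟩ := exists_circle_kernel (r := r / (p + 1)) (by positivity)
  choose a ha using fun j : Fin p → ZMod N =>
    Torus.surjective_mk (fun i => ZMod.toAddCircle (j i) : Torus p)
  refine ⟨Fin p → ZMod N, inferInstance, a, fun x => ∏ i, k (x i), ?_,
    fun x => Finset.prod_nonneg fun i _ => hk0 _, fun x => ?_, fun x hx => ?_⟩
  · exact contDiff_prod fun i _ => hk.comp (by fun_prop)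
  · simp only [ha, Pi.sub_apply]
    rw [← Fintype.prod_sum fun i j => k (x i - ZMod.toAddCircle j)]
    simp [hk1]
  · rw [Finset.prod_ne_zero_iff] at hx
    choose s hs hs' using fun i => hks (x i) (hx i (Finset.mem_univ i))
    refine ⟨WithLp.toLp 2 s, ?_, funext fun i => hs' i⟩
    refine (norm_le_of_forall_abs_le (ε := r / (p + 1)) fun i => (hs i).le).trans_lt ?_
    rw [mul_div_assoc', div_lt_iff₀ (by positivity)]
    linarith

end

section

variable {p : ℕ}

/-! ### Transported densities and admissible pairs -/

/-- Transport identity: a kernel carried along a curve `X` ending at `a` pairs with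
`∂ₜg + X' · ∇g`, the derivative of `g` along the translated curves, to the final value of `g`. -/
theorem integral_transport {T : ℝ} (hT : 0 < T) {K : Torus p → ℝ} (hK : Continuous K)
    {X V : ℝ → Vec p} {a : Vec p} (hX : ContinuousOn X (Icc 0 T)) (hV : ContinuousOn V (Icc 0 T))
    (hXV : ∀ t ∈ Ioo 0 T, HasDerivAt X (V t) t) (hXT : X T = a)
    {g h : ℝ × Torus p → ℝ} (hg : SmoothField T g) (hg0 : ∀ x, g (0, x) = 0)
    (hh : ContinuousOn h (Icc 0 T ×ˢ univ))
    (hgh : ∀ t ∈ Ioo 0 T, ∀ x, HasDerivAt (fun s => g (s, x)) (h (t, x)) t) :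
    ∫ z, K (z.2 - Torus.mk (X z.1)) * (h z
      + inner ℝ (V z.1) (torusGrad (fun x => g (z.1, x)) z.2)) ∂(spaceTime p T)
      = ∫ x, K (x - Torus.mk a) * g (T, x) := by
  obtain ⟨h', hh', hgrad, hgh', hchain⟩ := hg.exists_timeDeriv hT
  have hfst : MapsTo (Prod.fst : ℝ × Torus p → ℝ) (Icc 0 T ×ˢ univ) (Icc 0 T) := fun z hz => hz.1
  have hX' : ContinuousOn (fun z : ℝ × Torus p => Torus.mk (X z.1)) (Icc 0 T ×ˢ univ) :=
    Torus.continuous_mk.comp_continuousOn (hX.comp continuousOn_fst hfst)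
  have hV' : ContinuousOn (fun z : ℝ × Torus p => V z.1) (Icc 0 T ×ˢ univ) :=
    hV.comp continuousOn_fst hfst
  set H : ℝ × Torus p → ℝ := fun z => h z
      + inner ℝ (V z.1) (torusGrad (fun x => g (z.1, x)) z.2) with hH
  have hHc : ContinuousOn H (Icc 0 T ×ˢ univ) := hh.add (hV'.inner hgrad)
  have hshift : ContinuousOn (fun z : ℝ × Torus p => (z.1, z.2 + Torus.mk (X z.1)))
      (Icc 0 T ×ˢ univ) := continuousOn_fst.prodMk (continuousOn_snd.add hX')
  have hHs : ContinuousOn (fun z : ℝ × Torus p => H (z.1, z.2 + Torus.mk (X z.1)))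
      (Icc 0 T ×ˢ univ) := hHc.comp hshift fun z hz => ⟨hz.1, mem_univ _⟩
  have hi1 : Integrable (fun z : ℝ × Torus p => K (z.2 - Torus.mk (X z.1)) * H z)
      (spaceTime p T) :=
    integrable_of_continuousOn_slab ((hK.comp_continuousOn (continuousOn_snd.sub hX')).mul hHc)
  have hi2 : Integrable (fun z : ℝ × Torus p => K z.2 * H (z.1, z.2 + Torus.mk (X z.1)))
      (spaceTime p T) :=
    integrable_of_continuousOn_slab ((hK.comp continuous_snd).continuousOn.mul hHs)
  -- along a translate of the curve, `H` is the derivative of `g`, which starts from zero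
  have hline : ∀ x : Torus p,
      ∫ t in Ioo 0 T, H (t, x + Torus.mk (X t)) = g (T, x + Torus.mk a) := by
    intro x
    obtain ⟨y, rfl⟩ := Torus.surjective_mk x
    have hlc : ContinuousOn (fun s => (s, Torus.mk (y + X s))) (Icc 0 T) :=
      continuousOn_id.prodMk (Torus.continuous_mk.comp_continuousOn (continuousOn_const.add hX))
    have hlm : MapsTo (fun s => (s, Torus.mk (y + X s))) (Icc 0 T) (Icc 0 T ×ˢ univ) :=
      fun s hs => ⟨hs, mem_univ _⟩
    have h1 := intervalIntegral.integral_eq_sub_of_hasDerivAt_of_le hT.le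
      (f := fun s => g (s, Torus.mk (y + X s))) (f' := fun s => H (s, Torus.mk (y + X s)))
      (hg.continuousOn.comp hlc hlm) (fun t ht => by
        have h2 := hchain t ht y X (V t) (hXV t ht)
        rwa [(hgh' t ht _).unique (hgh t ht _)] at h2)
      ((hHc.comp hlc hlm).intervalIntegrable_of_Icc hT.le)
    rw [intervalIntegral.integral_of_le hT.le, integral_Ioc_eq_integral_Ioo] at h1
    simpa only [Torus.mk_add, hg0, hXT, sub_zero] using h1
  have e1 : ∫ z, K (z.2 - Torus.mk (X z.1)) * H z ∂(spaceTime p T)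
      = ∫ z, K z.2 * H (z.1, z.2 + Torus.mk (X z.1)) ∂(spaceTime p T) := by
    unfold spaceTime at hi1 hi2 ⊢
    rw [integral_prod _ hi1, integral_prod _ hi2]
    refine integral_congr_ae (Eventually.of_forall fun t => ?_)
    have := integral_add_right_eq_self (μ := (volume : Measure (Torus p)))
      (fun x => K (x - Torus.mk (X t)) * H (t, x)) (Torus.mk (X t))
    simpa only [add_sub_cancel_right] using this.symm
  rw [e1]
  unfold spaceTime at hi2 ⊢
  rw [integral_prod_symm _ hi2]
  simp only [integral_const_mul, hline]
  have := integral_add_right_eq_self (μ := (volume : Measure (Torus p)))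
      (fun x => K (x - Torus.mk a) * g (T, x)) (Torus.mk a)
  simpa only [add_sub_cancel_right] using this

/-- A scalar density `ρ` and a field `E` satisfying the weak form of `∂ₜρ = div E`, `ρ(T) = 1`, give
the admissible pair `(E, ½ (ρ - 1) I)`. -/
theorem admissible_of_continuity_equation {T : ℝ} (hT : 0 < T) {E : ℝ × Torus p → Vec p}
    {ρ : ℝ × Torus p → ℝ} (hE : ContinuousOn E (Icc 0 T ×ˢ univ))
    (hρ : ContinuousOn ρ (Icc 0 T ×ˢ univ))
    (hweak : ∀ g h : ℝ × Torus p → ℝ, SmoothField T g → (∀ x, g (0, x) = 0) →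
      ContinuousOn h (Icc 0 T ×ˢ univ) →
      (∀ t ∈ Ioo 0 T, ∀ x, HasDerivAt (fun s => g (s, x)) (h (t, x)) t) →
      ∫ z, ((ρ z - 1) * h z - inner ℝ (E z) (torusGrad (fun x => g (z.1, x)) z.2))
        ∂(spaceTime p T) = 0) :
    Admissible T E (fun z => ((ρ z - 1) / 2) • (1 : Mat p)) where
  memLp_E := memLp_of_continuousOn_slab hE 2
  memLp_B i j := by
    refine memLp_of_continuousOn_slab ?_ _
    exact ((hρ.sub continuousOn_const).div_const 2).mul continuousOn_const
  symm_B := Eventually.of_forall fun z => by simp [Matrix.IsSymm]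
  constraint Ψ hΨ := by
    obtain ⟨h, hh, -, hgh, -⟩ := hΨ.smooth.opU.exists_timeDeriv hT
    have hz := hweak (fun z => opU (Ψ z)) h hΨ.smooth.opU
      (fun x => by simp [opU, hΨ.initial]) hh hgh
    rw [← hz]
    refine integral_congr_ae ?_
    filter_upwards [ae_spaceTime_mem p T] with z ht
    have h1 : HasDerivAt (fun s => opU (Ψ (s, z.2))) ((1 / 2) * ∑ i, timeDeriv Ψ z i i) z.1 := by
      have h2 : ∀ i, HasDerivAt (fun s => Ψ (s, z.2) i i) (timeDeriv Ψ z i i) z.1 := fun i => by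
        obtain ⟨hi, -, -, hgi, -⟩ := (hΨ.smooth i i).exists_timeDeriv hT
        exact (hgi z.1 ht z.2).differentiableAt.hasDerivAt
      have h3 := (HasDerivAt.fun_sum (u := Finset.univ) fun i _ => h2 i).const_mul (1 / 2 : ℝ)
      simpa only [opU, Matrix.trace, Matrix.diag_apply] using h3
    have h4 : h z = (1 / 2) * ∑ i, timeDeriv Ψ z i i := (hgh z.1 ht z.2).unique h1
    have h5 : frob (((ρ z - 1) / 2) • (1 : Mat p)) (timeDeriv Ψ z)
        = (ρ z - 1) / 2 * ∑ i, timeDeriv Ψ z i i := by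
      simp [frob, Matrix.one_apply, Finset.mul_sum]
    simp only [h5, h4, opL, inner_neg_right]
    ring

/-- Densities transported along approximate characteristics: for every `ε` there is a smooth
admissible pair `(E, ½ (ρ - 1) I)` with `ρ > 0` and `E + ρ v` of `L¹` norm at most `ε`. The density
is a superposition of kernels moving along integral curves of a smooth field close to `v`, plus a
small constant. -/
theorem exists_admissible_density {T : ℝ} (hT : 0 < T) {v : ℝ × Torus p → Vec p}
    (hv : ContinuousOn v (Icc 0 T ×ˢ univ)) {ε : ℝ} (hε : 0 < ε) :
    ∃ (E : ℝ × Torus p → Vec p) (ρ : ℝ × Torus p → ℝ), SmoothField T E ∧ SmoothField T ρ ∧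
      (∀ z, 0 < ρ z) ∧ Admissible T E (fun z => ((ρ z - 1) / 2) • (1 : Mat p)) ∧
      eLpNorm (fun z => E z + ρ z • v z) 1 (spaceTime p T) ≤ ENNReal.ofReal ε := by
  obtain ⟨M, hM0, hM⟩ := exists_norm_bound_slab hv
  -- `η` bounds both local errors, `δ` is the weight of the constant background density
  set η := ε / (3 * T) with hη
  have hη0 : 0 < η := by positivity
  set δ := min (1 / 2) (η / (M + 1)) with hδ
  have hδ0 : 0 < δ := lt_min (by norm_num) (by positivity)
  have hδ1 : δ < 1 := (min_le_left _ _).trans_lt (by norm_num)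
  have hδM : δ * M ≤ η := by
    have : δ * (M + 1) ≤ η := by
      rw [← le_div_iff₀ (by positivity)]; exact min_le_right _ _
    linarith
  obtain ⟨w, hw, hwv⟩ := exists_smooth_approx hT hv hη0
  obtain ⟨r, hr, hunif⟩ := exists_unif_slab hv hη0
  obtain ⟨ι, _, a, K, hKs, hK0, hK1, hKsupp⟩ := exists_torus_kernel p hr
  choose X hXs hXT hX using fun i => exists_smooth_curve hT hw (a i)
  have hKc : Continuous K := Torus.continuous_of_lift hKs.continuous
  set V : ι → ℝ → Vec p := fun i t => w (t, Torus.mk (X i t)) with hV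
  have hVs : ∀ i, ContDiffOn ℝ ∞ (V i) (Icc 0 T) := fun i =>
    hw.comp_contDiffOn (contDiffOn_id.prodMk (hXs i))
  have hXV : ∀ i, ∀ t ∈ Ioo 0 T, HasDerivAt (X i) (V i t) t := fun i t ht =>
    (hX i t (Ioo_subset_Icc_self ht)).hasDerivAt (Icc_mem_nhds ht.1 ht.2)
  set k : ι → ℝ × Torus p → ℝ := fun i z => K (z.2 - Torus.mk (X i z.1)) with hk
  have hfst : MapsTo (Prod.fst : ℝ × Vec p → ℝ) (Icc 0 T ×ˢ univ) (Icc 0 T) := fun z hz => hz.1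
  have hks : ∀ i, SmoothField T (k i) := by
    intro i
    have h1 : ContDiffOn ℝ ∞ (fun z : ℝ × Vec p => z.2 - X i z.1) (Icc 0 T ×ˢ univ) :=
      contDiffOn_snd.sub ((hXs i).comp contDiffOn_fst hfst)
    have h2 := hKs.comp_contDiffOn h1
    simp only [Function.comp_def, Torus.mk_sub] at h2
    exact h2
  set E : ℝ × Torus p → Vec p := fun z => -((1 - δ) • ∑ i, k i z • V i z.1) with hE
  set ρ : ℝ × Torus p → ℝ := fun z => (1 - δ) * ∑ i, k i z + δ with hρ
  have hEs : SmoothField T E := by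
    refine ContDiffOn.neg (ContDiffOn.const_smul _ (ContDiffOn.sum fun i _ => ?_))
    exact ContDiffOn.smul (hks i) ((hVs i).comp contDiffOn_fst hfst)
  have hρs : SmoothField T ρ :=
    (contDiffOn_const.mul (ContDiffOn.sum fun i _ => hks i)).add contDiffOn_const
  have hk0 : ∀ i z, 0 ≤ k i z := fun i z => hK0 _
  have hρ0 : ∀ z, 0 < ρ z := fun z => by
    have : 0 ≤ (1 - δ) * ∑ i, k i z :=
      mul_nonneg (by linarith) (Finset.sum_nonneg fun i _ => hk0 i z)
    simp only [hρ]; linarith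
  -- the total transport identity, used for the constraint and for the mass
  have htrans : ∀ g h : ℝ × Torus p → ℝ, SmoothField T g → (∀ x, g (0, x) = 0) →
      ContinuousOn h (Icc 0 T ×ˢ univ) →
      (∀ t ∈ Ioo 0 T, ∀ x, HasDerivAt (fun s => g (s, x)) (h (t, x)) t) →
      (∀ i, Integrable (fun z => k i z * (h z + inner ℝ (V i z.1)
        (torusGrad (fun x => g (z.1, x)) z.2))) (spaceTime p T)) ∧
      ∫ z, ∑ i, k i z * (h z + inner ℝ (V i z.1) (torusGrad (fun x => g (z.1, x)) z.2))
        ∂(spaceTime p T) = ∫ x, g (T, x) := by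
    intro g h hg hg0 hh hgh
    obtain ⟨_, -, hgrad, -, -⟩ := hg.exists_timeDeriv hT
    have hint : ∀ i, Integrable (fun z => k i z * (h z + inner ℝ (V i z.1)
        (torusGrad (fun x => g (z.1, x)) z.2))) (spaceTime p T) := fun i => by
      refine integrable_of_continuousOn_slab ((hks i).continuousOn.mul (hh.add ?_))
      exact ((hVs i).continuousOn.comp continuousOn_fst fun z hz => hz.1).inner hgrad
    refine ⟨hint, ?_⟩
    have hgT : Continuous fun x => g (T, x) :=
      continuous_slice hg.continuousOn (right_mem_Icc.2 hT.le)
    rw [integral_finsetSum _ fun i _ => hint i, Finset.sum_congr rfl fun i _ =>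
      integral_transport hT hKc (hXs i).continuousOn (hVs i).continuousOn (hXV i) (hXT i) hg hg0 hh
        hgh, ← integral_finsetSum]
    · refine integral_congr_ae (Eventually.of_forall fun x => ?_)
      simp only [← Finset.sum_mul, hK1, one_mul]
    · intro i _
      refine Continuous.integrable_of_hasCompactSupport ?_ (HasCompactSupport.of_compactSpace _)
      exact (hKc.comp (continuous_id.sub continuous_const)).mul hgT
  -- the case `g(t,x) = t`
  have hmass : ∫ z, ∑ i, k i z ∂(spaceTime p T) = T := by
    have h1 := (htrans (fun z => z.1) (fun _ => 1) contDiffOn_fst (fun _ => rfl) continuousOn_const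
      (fun t _ _ => hasDerivAt_id t)).2
    have h2 : ∀ (c : ℝ) (x : Torus p), torusGrad (fun _ => c) x = 0 := fun c x => by
      ext i; simp [torusGrad]
    simpa [h2] using h1
  refine ⟨E, ρ, hEs, hρs, hρ0, ?_, ?_⟩
  · refine admissible_of_continuity_equation hT hEs.continuousOn hρs.continuousOn
      fun g h hg hg0 hh hgh => ?_
    obtain ⟨hi, h1⟩ := htrans g h hg hg0 hh hgh
    have hhi : Integrable h (spaceTime p T) := integrable_of_continuousOn_slab hh
    -- the background density is the case of a constant kernel at rest
    have h2 : ∫ z, h z ∂(spaceTime p T) = ∫ x, g (T, x) := by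
      simpa using integral_transport hT (K := fun _ => 1) continuous_const (X := fun _ => 0)
        (V := fun _ => 0) (a := 0) continuousOn_const continuousOn_const
        (fun t _ => hasDerivAt_const t 0) rfl hg hg0 hh hgh
    have h3 : ∀ z, (ρ z - 1) * h z - inner ℝ (E z) (torusGrad (fun x => g (z.1, x)) z.2)
        = (1 - δ) * ((∑ i, k i z * (h z + inner ℝ (V i z.1)
          (torusGrad (fun x => g (z.1, x)) z.2))) - h z) := by
      intro z
      simp only [hρ, hE, inner_neg_left, real_inner_smul_left, sum_inner, mul_add,
        Finset.sum_add_distrib, ← Finset.sum_mul]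
      ring
    simp only [h3]
    rw [integral_const_mul, integral_sub (integrable_finsetSum _ fun i _ => hi i) hhi, h1, h2,
      sub_self, mul_zero]
  · have hvb : ContinuousOn (fun z => E z + ρ z • v z) (Icc 0 T ×ˢ univ) :=
      hEs.continuousOn.add (hρs.continuousOn.smul hv)
    have hvi := integrable_of_continuousOn_slab hvb
    have hki : Integrable (fun z => ∑ i, k i z) (spaceTime p T) :=
      integrable_of_continuousOn_slab (continuousOn_finsetSum _ fun i _ => (hks i).continuousOn)
    have hbound : ∀ t ∈ Icc 0 T, ∀ x, ‖E (t, x) + ρ (t, x) • v (t, x)‖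
        ≤ 2 * η * ∑ i, k i (t, x) + η := by
      intro t ht x
      have h1 : E (t, x) + ρ (t, x) • v (t, x)
          = (1 - δ) • (∑ i, k i (t, x) • (v (t, x) - V i t)) + δ • v (t, x) := by
        simp only [hE, hρ, smul_sub, Finset.sum_sub_distrib, ← Finset.sum_smul, add_smul, mul_smul]
        abel
      have h2 : ∀ i, ‖k i (t, x) • (v (t, x) - V i t)‖ ≤ k i (t, x) * (2 * η) := by
        intro i
        rw [norm_smul, Real.norm_of_nonneg (hk0 i _)]
        by_cases hz : k i (t, x) = 0
        · simp [hz]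
        · refine mul_le_mul_of_nonneg_left ?_ (hk0 i _)
          obtain ⟨s, hs, hsx⟩ := hKsupp _ hz
          have h3 : x = Torus.mk (X i t) + Torus.mk s := by rw [hsx]; abel
          have h4 := hunif t ht (Torus.mk (X i t)) s hs
          have h5 := hwv t ht (Torus.mk (X i t))
          rw [← h3] at h4
          rw [norm_sub_rev] at h5
          have h6 := norm_add_le_of_le h4 h5
          rw [sub_add_sub_cancel] at h6
          linarith
      have h3 : ‖∑ i, k i (t, x) • (v (t, x) - V i t)‖ ≤ 2 * η * ∑ i, k i (t, x) := by
        refine (norm_sum_le _ _).trans ((Finset.sum_le_sum fun i _ => h2 i).trans ?_)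
        rw [← Finset.sum_mul, mul_comm]
      rw [h1]
      refine (norm_add_le _ _).trans (add_le_add ?_ ?_)
      · rw [norm_smul, Real.norm_of_nonneg (by linarith)]
        exact (mul_le_of_le_one_left (norm_nonneg _) (by linarith)).trans h3
      · rw [norm_smul, Real.norm_of_nonneg hδ0.le]
        exact (mul_le_mul_of_nonneg_left (hM t ht x) hδ0.le).trans hδM
    rw [eLpNorm_one_eq_lintegral_enorm, ← ofReal_integral_norm_eq_lintegral_enorm hvi]
    refine ENNReal.ofReal_le_ofReal ?_
    have hle : ∫ z, ‖E z + ρ z • v z‖ ∂(spaceTime p T)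
        ≤ ∫ z, (2 * η * ∑ i, k i z + η) ∂(spaceTime p T) := by
      refine integral_mono_ae hvi.norm ((hki.const_mul _).add (integrable_const _)) ?_
      filter_upwards [ae_spaceTime_mem p T] with z hz
      exact hbound z.1 (Ioo_subset_Icc_self hz) z.2
    refine hle.trans (le_of_eq ?_)
    rw [integral_add (hki.const_mul _) (integrable_const _), integral_const_mul, hmass,
      integral_const, measureReal_spaceTime_univ hT, smul_eq_mul, hη]
    field_simp
    ring

end

section

variable {p : ℕ}

/-! ### The saddle functional -/

theorem frob_comm (A B : Mat p) : frob A B = frob B A := by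
  simp only [frob, mul_comm]

theorem frob_one_add_two_smul (A B : Mat p) :
    frob A (1 + (2 : ℝ) • B) = A.trace + 2 * frob A B := by
  simp only [frob, Matrix.add_apply, Matrix.smul_apply, smul_eq_mul, mul_add,
    Finset.sum_add_distrib, Matrix.trace, Matrix.diag_apply, Finset.mul_sum]
  congr 1
  · simp [Matrix.one_apply]
  · exact Finset.sum_congr rfl fun i _ => Finset.sum_congr rfl fun j _ => by ring

theorem frob_smul_one (A : Mat p) (c : ℝ) : frob A (c • (1 : Mat p)) = c * A.trace := by
  simp [frob, Matrix.one_apply, Matrix.trace, Finset.mul_sum, mul_comm]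

theorem trace_tsq (w : Vec p) : (tsq w).trace = inner ℝ w w := by
  rw [real_inner_self_eq_norm_sq, EuclideanSpace.real_norm_sq_eq]
  simp [tsq, Matrix.trace, pow_two]

theorem one_add_two_smul_half (c : ℝ) :
    (1 : Mat p) + (2 : ℝ) • (((c - 1) / 2) • (1 : Mat p)) = c • (1 : Mat p) := by
  rw [smul_smul]
  nth_rewrite 1 [← one_smul ℝ (1 : Mat p)]
  rw [← add_smul]
  congr 1
  ring

theorem integrable_tsq {T : ℝ} {w : ℝ × Torus p → Vec p} (hw : MemLp w 2 (spaceTime p T))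
    (i j : Fin p) : Integrable (fun z => tsq (w z) i j) (spaceTime p T) := by
  have h : ∀ i, MemLp (fun z => w z i) 2 (spaceTime p T) := fun i =>
    (EuclideanSpace.proj (𝕜 := ℝ) i : Vec p →L[ℝ] ℝ).comp_memLp' hw
  exact (h i).integrable_mul (h j)

section Duality

variable {T : ℝ} {v₀ : Torus p → Vec p} {vbar w : ℝ × Torus p → Vec p}
  {E : ℝ × Torus p → Vec p} {B : ℝ × Torus p → Mat p}

theorem Admissible.integrable_frob_tsq (hadm : Admissible T E B)
    (hw : MemLp w 2 (spaceTime p T)) :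
    Integrable (fun z => frob (tsq (w z)) (B z)) (spaceTime p T) := by
  simp only [frob_comm (tsq _)]
  exact integrable_frob_of_memLp hadm.memLp_B (integrable_tsq hw)

theorem Admissible.integrable_saddle (hadm : Admissible T E B)
    (hv₀ : MemLp (fun z : ℝ × Torus p => v₀ z.2) 2 (spaceTime p T))
    (hvb : MemLp vbar 2 (spaceTime p T)) (hw : MemLp w 2 (spaceTime p T)) :
    Integrable (fun z => (1 / 2) * inner ℝ (w z - vbar z) (w z - vbar z)
      + inner ℝ (w z - v₀ z.2) (E z) + frob (tsq (w z)) (B z)) (spaceTime p T) :=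
  ((((integrable_inner_of_memLp_two (hw.sub hvb) (hw.sub hvb)).const_mul _)).add
    (integrable_inner_of_memLp_two (hw.sub hv₀) hadm.memLp_E)).add (hadm.integrable_frob_tsq hw)

theorem integrable_baseConst (hv₀ : MemLp (fun z : ℝ × Torus p => v₀ z.2) 2 (spaceTime p T))
    (hvb : MemLp vbar 2 (spaceTime p T)) :
    Integrable (fun z => -inner ℝ (v₀ z.2) (vbar z) + (1 / 2) * inner ℝ (vbar z) (vbar z))
      (spaceTime p T) :=
  (integrable_inner_of_memLp_two hv₀ hvb).neg.add
    ((integrable_inner_of_memLp_two hvb hvb).const_mul _)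

/-- The dual functional is the primal one, rearranged. -/
theorem Admissible.integral_dual_eq (hadm : Admissible T E B)
    (hv₀ : MemLp (fun z : ℝ × Torus p => v₀ z.2) 2 (spaceTime p T))
    (hvb : MemLp vbar 2 (spaceTime p T)) (hw : MemLp w 2 (spaceTime p T)) :
    (∫ z, (inner ℝ (w z - v₀ z.2) (E z - vbar z)
        + (1 / 2) * frob (tsq (w z)) (1 + (2 : ℝ) • B z)) ∂(spaceTime p T))
      + baseConst v₀ vbar T
    = ∫ z, ((1 / 2) * inner ℝ (w z - vbar z) (w z - vbar z)
        + inner ℝ (w z - v₀ z.2) (E z) + frob (tsq (w z)) (B z)) ∂(spaceTime p T) := by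
  have h : ∀ z, inner ℝ (w z - v₀ z.2) (E z - vbar z)
        + (1 / 2) * frob (tsq (w z)) (1 + (2 : ℝ) • B z)
      = ((1 / 2) * inner ℝ (w z - vbar z) (w z - vbar z)
        + inner ℝ (w z - v₀ z.2) (E z) + frob (tsq (w z)) (B z))
        - (-inner ℝ (v₀ z.2) (vbar z) + (1 / 2) * inner ℝ (vbar z) (vbar z)) := by
    intro z
    rw [frob_one_add_two_smul, trace_tsq]
    simp only [inner_sub_left, inner_sub_right, real_inner_comm (vbar z) (w z)]
    ring
  simp only [h]
  rw [integral_sub (hadm.integrable_saddle hv₀ hvb hw) (integrable_baseConst hv₀ hvb), baseConst,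
    sub_add_cancel]

theorem dualValue_le_primalValue
    (hv₀ : MemLp (fun z : ℝ × Torus p => v₀ z.2) 2 (spaceTime p T))
    (hvb : MemLp vbar 2 (spaceTime p T)) : dualValue v₀ vbar T ≤ primalValue v₀ vbar T := by
  refine iSup_le fun E => iSup_le fun B => iSup_le fun hadm => le_iInf fun w => le_iInf fun hw => ?_
  refine (iInf₂_le w hw).trans ?_
  rw [hadm.integral_dual_eq hv₀ hvb hw]
  exact le_iSup_of_le E (le_iSup_of_le B (le_iSup_of_le hadm le_rfl))

/-- At a field `v` satisfying the weak form, the saddle functional does not depend on `(E,B)`. -/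
theorem Admissible.integral_saddle_eq (hadm : Admissible T E B) {v : ℝ × Torus p → Vec p}
    (hv₀ : MemLp (fun z : ℝ × Torus p => v₀ z.2) 2 (spaceTime p T))
    (hvb : MemLp vbar 2 (spaceTime p T)) (hv : MemLp v 2 (spaceTime p T))
    (hweak : ∫ z, (frob (B z) (tsq (v z)) + inner ℝ (E z) (v z - v₀ z.2)) ∂(spaceTime p T) = 0) :
    ∫ z, ((1 / 2) * inner ℝ (v z - vbar z) (v z - vbar z)
        + inner ℝ (v z - v₀ z.2) (E z) + frob (tsq (v z)) (B z)) ∂(spaceTime p T)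
      = ∫ z, (1 / 2) * inner ℝ (v z - vbar z) (v z - vbar z) ∂(spaceTime p T) := by
  have h : ∀ z, (1 / 2) * inner ℝ (v z - vbar z) (v z - vbar z)
        + inner ℝ (v z - v₀ z.2) (E z) + frob (tsq (v z)) (B z)
      = (1 / 2) * inner ℝ (v z - vbar z) (v z - vbar z)
        + (frob (B z) (tsq (v z)) + inner ℝ (E z) (v z - v₀ z.2)) := by
    intro z
    rw [frob_comm, real_inner_comm (E z)]
    ring
  simp only [h]
  have h1 : Integrable (fun z => (1 / 2) * inner ℝ (v z - vbar z) (v z - vbar z))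
      (spaceTime p T) := (integrable_inner_of_memLp_two (hv.sub hvb) (hv.sub hvb)).const_mul _
  have h2 : Integrable (fun z => frob (B z) (tsq (v z)) + inner ℝ (E z) (v z - v₀ z.2))
      (spaceTime p T) :=
    integrable_pairing hadm.memLp_E hadm.memLp_B (integrable_tsq hv) (hv.sub hv₀)
  rw [integral_add h1 h2, hweak, add_zero]

/-- Completing the square: with `I + 2B = ρ I` and `E - v̄ = -ρ v`, the dual integrand is minimal
at `v`. -/
theorem neg_mul_inner_add_le {c : ℝ} (hc : 0 ≤ c) (v w : Vec p) :
    -c * inner ℝ v v + (1 / 2) * (c * inner ℝ v v) ≤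
      -c * inner ℝ w v + (1 / 2) * (c * inner ℝ w w) := by
  have h := mul_nonneg hc (real_inner_self_nonneg (x := w - v))
  simp only [inner_sub_left, inner_sub_right, real_inner_comm w v] at h
  linarith

theorem inner_self_le_trace {z : Vec p} {M : Mat p} (h : (M - tsq z).PosSemidef) :
    inner ℝ z z ≤ M.trace := by
  have := h.trace_nonneg
  rwa [Matrix.trace_sub, trace_tsq, sub_nonneg] at this

theorem momentPair_tsq {v : ℝ × Torus p → Vec p} (hv : MemLp v 2 (spaceTime p T)) :
    MomentPair T v fun z => tsq (v z) where
  memLp_z := hv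
  memLp_M i j := memLp_one_iff_integrable.2 (integrable_tsq hv i j)
  symm_M := Eventually.of_forall fun y => by
    ext i j
    simp [tsq, mul_comm]
  le := Eventually.of_forall fun y => by
    rw [sub_self]
    exact Matrix.PosSemidef.zero

/-- The saddle functional is also the constrained dual objective with the moment pair
`(w, w ⊗ w)` in the functional `K`. -/
theorem Admissible.integral_objective_eq (hadm : Admissible T E B)
    (hv₀ : MemLp (fun z : ℝ × Torus p => v₀ z.2) 2 (spaceTime p T))
    (hvb : MemLp vbar 2 (spaceTime p T)) (hw : MemLp w 2 (spaceTime p T)) :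
    (∫ z, (-inner ℝ (v₀ z.2) (E z) + (1 / 2) * inner ℝ (vbar z) (vbar z)) ∂(spaceTime p T))
      + (∫ y, (inner ℝ (w y) (E y - vbar y) + (1 / 2) * frob (tsq (w y)) (1 + (2 : ℝ) • B y))
        ∂(spaceTime p T))
    = ∫ z, ((1 / 2) * inner ℝ (w z - vbar z) (w z - vbar z)
        + inner ℝ (w z - v₀ z.2) (E z) + frob (tsq (w z)) (B z)) ∂(spaceTime p T) := by
  have hi1 : Integrable (fun z => -inner ℝ (v₀ z.2) (E z) + (1 / 2) * inner ℝ (vbar z) (vbar z))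
      (spaceTime p T) := (integrable_inner_of_memLp_two hv₀ hadm.memLp_E).neg.add
    ((integrable_inner_of_memLp_two hvb hvb).const_mul _)
  have h : ∀ y, inner ℝ (w y) (E y - vbar y) + (1 / 2) * frob (tsq (w y)) (1 + (2 : ℝ) • B y)
      = ((1 / 2) * inner ℝ (w y - vbar y) (w y - vbar y)
        + inner ℝ (w y - v₀ y.2) (E y) + frob (tsq (w y)) (B y))
        - (-inner ℝ (v₀ y.2) (E y) + (1 / 2) * inner ℝ (vbar y) (vbar y)) := by
    intro z
    rw [frob_one_add_two_smul, trace_tsq]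
    simp only [inner_sub_left, inner_sub_right, real_inner_comm (vbar z) (w z)]
    ring
  simp only [h]
  rw [integral_sub (hadm.integrable_saddle hv₀ hvb hw) hi1, add_sub_cancel]

end Duality

/-- The duality argument: a weak solution `v` and an admissible pair with `I + 2B = ρ I`, `ρ > 0`,
`E - v̄ = -ρ v` form a saddle point, hence there is no duality gap and `(E, B)` is optimal. -/
theorem duality_of_density {T : ℝ} {v₀ : Torus p → Vec p} {v : ℝ × Torus p → Vec p}
    (hv₀ : MemLp (fun z : ℝ × Torus p => v₀ z.2) 2 (spaceTime p T))
    (hv : ContinuousOn v (Icc 0 T ×ˢ univ))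
    (hweak : ∀ E B, Admissible T E B →
      ∫ z, (frob (B z) (tsq (v z)) + inner ℝ (E z) (v z - v₀ z.2)) ∂(spaceTime p T) = 0)
    {E : ℝ × Torus p → Vec p} {ρ : ℝ × Torus p → ℝ} (hE : ContinuousOn E (Icc 0 T ×ˢ univ))
    (hρ : ContinuousOn ρ (Icc 0 T ×ˢ univ)) (hρ0 : ∀ z, 0 < ρ z)
    (hadm : Admissible T E (fun z => ((ρ z - 1) / 2) • (1 : Mat p))) :
    primalValue v₀ (fun z => E z + ρ z • v z) T = dualValue v₀ (fun z => E z + ρ z • v z) T ∧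
      IsDualSolution v₀ (fun z => E z + ρ z • v z) T E
        (fun z => ((ρ z - 1) / 2) • (1 : Mat p)) := by
  set vbar : ℝ × Torus p → Vec p := fun z => E z + ρ z • v z with hvbar
  set B : ℝ × Torus p → Mat p := fun z => ((ρ z - 1) / 2) • (1 : Mat p) with hB
  have hvL : MemLp v 2 (spaceTime p T) := memLp_of_continuousOn_slab hv 2
  have hvb : MemLp vbar 2 (spaceTime p T) :=
    memLp_of_continuousOn_slab (hE.add (hρ.smul hv)) 2
  have hIB : ∀ z, 1 + (2 : ℝ) • B z = ρ z • (1 : Mat p) := fun z => one_add_two_smul_half (ρ z)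
  have hEv : ∀ z, E z - vbar z = -(ρ z • v z) := fun z => by simp [hvbar]
  set D : ℝ := ∫ z, (1 / 2) * inner ℝ (v z - vbar z) (v z - vbar z) ∂(spaceTime p T) with hD
  have hsaddle : ∀ E' B', Admissible T E' B' →
      ∫ z, ((1 / 2) * inner ℝ (v z - vbar z) (v z - vbar z)
        + inner ℝ (v z - v₀ z.2) (E' z) + frob (tsq (v z)) (B' z)) ∂(spaceTime p T) = D :=
    fun E' B' h => h.integral_saddle_eq hv₀ hvb hvL (hweak E' B' h)
  have hprimal : primalValue v₀ vbar T ≤ D := by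
    refine (iInf₂_le v hvL).trans ?_
    refine iSup_le fun E' => iSup_le fun B' => iSup_le fun h => ?_
    rw [hsaddle E' B' h]
  have hρC : ∀ {f : ℝ × Torus p → ℝ}, Integrable f (spaceTime p T) →
      Integrable (fun z => ρ z * f z) (spaceTime p T) := fun hf =>
    hf.mul_of_top_right (memLp_of_continuousOn_slab hρ ∞)
  have hEvL : MemLp (fun z => E z - vbar z) 2 (spaceTime p T) := hadm.memLp_E.sub hvb
  have hdual : (D : EReal) ≤ dualValue v₀ vbar T := by
    refine le_iSup_of_le E (le_iSup_of_le B (le_iSup_of_le hadm ?_))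
    refine le_iInf fun w => le_iInf fun hw => ?_
    rw [EReal.coe_le_coe_iff, ← hsaddle E B hadm, ← hadm.integral_dual_eq hv₀ hvb hvL]
    simp only [hIB, frob_smul_one, trace_tsq]
    refine add_le_add (integral_mono ?_ ?_ fun z => ?_) le_rfl
    · exact (integrable_inner_of_memLp_two (hvL.sub hv₀) hEvL).add
        ((hρC (integrable_inner_of_memLp_two hvL hvL)).const_mul _)
    · exact (integrable_inner_of_memLp_two (hw.sub hv₀) hEvL).add
        ((hρC (integrable_inner_of_memLp_two hw hw)).const_mul _)
    · have h1 := neg_mul_inner_add_le (hρ0 z).le (v z) (w z)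
      simp only [hEv, inner_neg_right, real_inner_smul_right, inner_sub_left]
      linarith
  have hDd : dualValue v₀ vbar T = D :=
    le_antisymm ((dualValue_le_primalValue hv₀ hvb).trans hprimal) hdual
  have hDp : primalValue v₀ vbar T = D :=
    le_antisymm hprimal (hdual.trans (dualValue_le_primalValue hv₀ hvb))
  have hle : ∀ E' B', Admissible T E' B' → dualObjective v₀ vbar T E' B' ≤ D := by
    intro E' B' h
    rw [← hsaddle E' B' h, ← h.integral_objective_eq hv₀ hvb hvL, EReal.coe_add]
    refine add_le_add le_rfl ?_
    exact iInf_le_of_le v (iInf_le_of_le _ (iInf_le_of_le (momentPair_tsq hvL) le_rfl))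
  have hge : (D : EReal) ≤ dualObjective v₀ vbar T E B := by
    rw [← hsaddle E B hadm, ← hadm.integral_objective_eq hv₀ hvb hvL, EReal.coe_add]
    refine add_le_add le_rfl ?_
    refine le_iInf fun y => le_iInf fun M => le_iInf fun hyM => ?_
    rw [EReal.coe_le_coe_iff]
    simp only [hIB, frob_smul_one]
    have htr : Integrable (fun z => (M z).trace) (spaceTime p T) :=
      integrable_finsetSum _ fun i _ => memLp_one_iff_integrable.1 (hyM.memLp_M i i)
    refine integral_mono_ae ?_ ?_ ?_
    · simp only [trace_tsq]
      exact (integrable_inner_of_memLp_two hvL hEvL).add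
        ((hρC (integrable_inner_of_memLp_two hvL hvL)).const_mul _)
    · exact (integrable_inner_of_memLp_two hyM.memLp_z hEvL).add ((hρC htr).const_mul _)
    · filter_upwards [hyM.le] with z hz
      have h1 := neg_mul_inner_add_le (hρ0 z).le (v z) (y z)
      have h2 := mul_le_mul_of_nonneg_left (inner_self_le_trace hz) (hρ0 z).le
      simp only [hEv, inner_neg_right, real_inner_smul_right, trace_tsq]
      linarith
  have hDo : dualObjective v₀ vbar T E B = D := le_antisymm (hle E B hadm) hge
  refine ⟨hDp.trans hDd.symm, ⟨hadm, Eventually.of_forall fun z => ?_⟩, fun E' B' h => ?_,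
    hDo.trans hDd.symm⟩
  · rw [hIB]
    exact Matrix.PosSemidef.one.smul (hρ0 z).le
  · rw [hDo]
    exact hle E' B' h.1

theorem inv_smul_one_mulVec {c : ℝ} (hc : c ≠ 0) (u : Vec p) :
    WithLp.toLp 2 ((c • (1 : Mat p))⁻¹.mulVec (WithLp.ofLp (c • u))) = u := by
  have h : (c • (1 : Mat p))⁻¹ = c⁻¹ • (1 : Mat p) :=
    Matrix.inv_eq_right_inv (by simp [smul_smul, hc])
  rw [h]
  ext i
  simp [Matrix.smul_mulVec, hc]

end

end HJDual

end

theorem corollary2p5 (p : ℕ) (hp : 1 ≤ p) (T : ℝ) (hT : 0 < T)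
    (ψs : HJDual.Torus p → ℝ) (ψ : ℝ × HJDual.Torus p → ℝ)
    (hψ : HJDual.IsViscositySolution T ψs ψ)
    (v₀ : HJDual.Torus p → HJDual.Vec p) (v : ℝ × HJDual.Torus p → HJDual.Vec p)
    (hgrad₀ : HJDual.IsTorusGradient ψs v₀)
    (hgrad : ∀ t ∈ Icc 0 T, HJDual.IsTorusGradient (fun x => ψ (t, x)) (fun x => v (t, x)))
    (hv₀ : Continuous v₀) (hv : ContinuousOn v (Icc 0 T ×ˢ univ)) :
    ∃ vbar : ℕ → ℝ × HJDual.Torus p → HJDual.Vec p,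
      (∀ m, ContinuousOn (vbar m) (Icc 0 T ×ˢ univ)) ∧
      Tendsto (fun m => eLpNorm (vbar m) 1 (HJDual.spaceTime p T)) atTop (𝓝 0) ∧
      (∀ m, HJDual.primalValue v₀ (vbar m) T = HJDual.dualValue v₀ (vbar m) T) ∧
      ∃ (E : ℕ → ℝ × HJDual.Torus p → HJDual.Vec p) (B : ℕ → ℝ × HJDual.Torus p → HJDual.Mat p),
        ∀ m, HJDual.IsDualSolution v₀ (vbar m) T (E m) (B m) ∧
          HJDual.SmoothField T (E m) ∧ HJDual.SmoothMatField T (B m) ∧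
          (∀ t ∈ Ioo 0 T, ∀ x, (1 + (2 : ℝ) • B m (t, x)).PosDef) ∧
          ∀ t ∈ Ioo 0 T, ∀ x,
            v (t, x) = WithLp.toLp 2
              ((1 + (2 : ℝ) • B m (t, x))⁻¹.mulVec (WithLp.ofLp (vbar m (t, x) - E m (t, x)))) := by
  choose E ρ hE hρ hρ0 hadm hnorm using fun m : ℕ =>
    HJDual.exists_admissible_density hT hv (ε := 1 / ((m : ℝ) + 1)) (by positivity)
  have hv₀L : MemLp (fun z : ℝ × HJDual.Torus p => v₀ z.2) 2 (HJDual.spaceTime p T) :=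
    HJDual.memLp_of_continuousOn_slab (hv₀.comp continuous_snd).continuousOn 2
  have hdual := fun m => HJDual.duality_of_density hv₀L hv
    (fun E B h => h.pairing_eq_zero hT hψ hv hv₀ hgrad₀ hgrad) (hE m).continuousOn
    (hρ m).continuousOn (hρ0 m) (hadm m)
  refine ⟨fun m z => E m z + ρ m z • v z,
    fun m => (hE m).continuousOn.add ((hρ m).continuousOn.smul hv), ?_, fun m => (hdual m).1, E,
    fun m z => ((ρ m z - 1) / 2) • (1 : HJDual.Mat p),
    fun m => ⟨(hdual m).2, hE m, fun i j => ?_, fun t _ x => ?_, fun t _ x => ?_⟩⟩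
  · refine tendsto_of_tendsto_of_tendsto_of_le_of_le tendsto_const_nhds ?_ (fun _ => zero_le) hnorm
    have := ENNReal.tendsto_ofReal (tendsto_one_div_add_atTop_nhds_zero_nat (𝕜 := ℝ))
    rwa [ENNReal.ofReal_zero] at this
  · exact (((hρ m).sub contDiffOn_const).div_const 2).mul contDiffOn_const
  · rw [HJDual.one_add_two_smul_half]
    exact Matrix.PosDef.one.smul (hρ0 m _)
  · rw [HJDual.one_add_two_smul_half, add_sub_cancel_left,
      HJDual.inv_smul_one_mulVec (hρ0 m _).ne']
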